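/- Let $r,r'\ge 1$ be cardinals, let $F$ be an infinite division ring, let $K$ be a field, and let $V$ be a left $F$-vector space of dimension $r+r'$, with $G=\mathrm{GL}_F(V)=\mathrm{Aut}_F(V)$. Let $\mathrm{Gr}=\mathrm{Gr}((r,r'),V)$ be the set of all $F$-subspaces of $V$ of dimension $r$ and codimension $r'$. For a commutative ring $A$ let $A[\mathrm{Gr}]$ be the permutation $A[G]$-module of finite formal $A$-linear combinations of elements of $\mathrm{Gr}$, and let $A[\mathrm{Gr}]^\circ$ be the submodule of the combinations whose coefficients sum to $0$. There are $L,L'\in\mathrm{Gr}$ with $\dim L/(L\cap L')=\dim L'/(L\cap L')=1$; for any such pair let $M_1\subseteq\mathbb Z[\mathrm{Gr}]^\circ$ be the $G$-submodule generated by $[L]-[L']$. Then the natural map $K\otimes_{\mathbb Z} M_1\to K[\mathrm{Gr}]$ is injective, and we identify $K\otimes M_1$ with its image. Every nonzero $K[G]$-submodule of $K[\mathrm{Gr}]$ contains $K\otimes M_1$. Moreover, $K\otimes M_1$ is irreducible, and it is the only irreducible $K[G]$-submodule of $K[\mathrm{Gr}]$. The following conditions are equivalent: (i) at least one of $r$ and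 $r'$ is finite; (ii) $M_1=\mathbb Z[\mathrm{Gr}]^\circ$; (iii) $K\otimes M_1=K[\mathrm{Gr}]^\circ$; (iv) $K[\mathrm{Gr}]^\circ$ is irreducible; (v) $K[\mathrm{Gr}]/(K\otimes M_1)$ is irreducible; (vi) $K[\mathrm{Gr}]/(K\otimes M_1)\cong K$ as $K[G]$-modules, where $G$ acts trivially on $K$. -/

import Mathlib

open scoped TensorProduct

noncomputable section

namespace GrassmannRep

universe u v w

/-- `Gr F V r r'` is the set of all `F`-vector subspaces of `V` of dimension `r` and of
codimension `r'`. -/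
def Gr (F : Type u) (V : Type v) [DivisionRing F] [AddCommGroup V] [Module F V]
    (r r' : Cardinal.{v}) : Type v :=
  {L : Submodule F V // Module.rank F L = r ∧ Module.rank F (V ⧸ L) = r'}

section

variable {F : Type u} {V : Type v} [DivisionRing F] [AddCommGroup V] [Module F V]
  {r r' : Cardinal.{v}}

/-- The group `GL_F(V) = Aut_F(V)` acts on the Grassmannian by `(g, L) ↦ g(L)`. Composition in
`V ≃ₗ[F] V` is that of maps written on the left, so that the right action of the automorphism
group whose elements are written on the right is the present left action. -/
instance : MulAction (V ≃ₗ[F] V) (Gr F V r r') where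
  smul g L := ⟨L.1.map (g : V →ₗ[F] V),
    (g.submoduleMap L.1).symm.rank_eq.trans L.2.1,
    (Submodule.Quotient.equiv L.1 (L.1.map (g : V →ₗ[F] V)) g rfl).symm.rank_eq.trans L.2.2⟩
  one_smul L := Subtype.ext (Submodule.map_id L.1)
  mul_smul g h L := Subtype.ext (Submodule.map_comp (h : V →ₗ[F] V) (g : V →ₗ[F] V) L.1)

/-- `dim L/(L ∩ L') = dim L'/(L ∩ L') = 1`. -/
def Adjacent (L L' : Gr F V r r') : Prop :=
  Module.rank F (L.1 ⧸ (L.1 ⊓ L'.1).submoduleOf L.1) = 1 ∧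
    Module.rank F (L'.1 ⧸ (L.1 ⊓ L'.1).submoduleOf L'.1) = 1

end

section

variable (F : Type u) (V : Type v) [DivisionRing F] [AddCommGroup V] [Module F V]
  (r r' : Cardinal.{v}) (A : Type w) [CommRing A]

/-- The permutation representation of `GL_F(V)` on the module `A[Gr]` of finite formal
`A`-linear combinations of points of the Grassmannian. -/
def rep : Representation A (V ≃ₗ[F] V) (Gr F V r r' →₀ A) where
  toFun g := Finsupp.lmapDomain A A (fun L => g • L)
  map_one' := by
    ext L : 2
    simp
  map_mul' g h := by
    ext L : 2
    simp [mul_smul]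

/-- The sum of the coefficients. -/
def degree : (Gr F V r r' →₀ A) →ₗ[A] A :=
  Finsupp.linearCombination A (fun _ => (1 : A))

/-- `A[Gr]°`: the formal combinations whose coefficients sum to zero. -/
def degreeZero : Subrepresentation (rep F V r r' A) where
  toSubmodule := LinearMap.ker (degree F V r r' A)
  apply_mem_toSubmodule g x hx := by
    have h : degree F V r r' A ∘ₗ rep F V r r' A g = degree F V r r' A := by
      ext L
      simp [degree, rep]
    rw [LinearMap.mem_ker] at hx ⊢
    rw [← hx]
    exact LinearMap.congr_fun h x

/-- The coefficientwise map `ℤ[Gr] → A[Gr]`. -/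
def intMap : (Gr F V r r' →₀ ℤ) →ₗ[ℤ] (Gr F V r r' →₀ A) :=
  Finsupp.mapRange.linearMap (Algebra.linearMap ℤ A)

end

section

variable {F : Type u} {V : Type v} [DivisionRing F] [AddCommGroup V] [Module F V]
  {r r' : Cardinal.{v}}

/-- The `GL_F(V)`-submodule of `ℤ[Gr]` generated by `[L] - [L']`. -/
def M1 (L L' : Gr F V r r') : Subrepresentation (rep F V r r' ℤ) where
  toSubmodule := Submodule.span ℤ (Set.range fun g : V ≃ₗ[F] V =>
    rep F V r r' ℤ g (Finsupp.single L 1 - Finsupp.single L' 1))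
  apply_mem_toSubmodule g x hx := by
    induction hx using Submodule.span_induction with
    | mem x hx =>
      obtain ⟨h, rfl⟩ := hx
      refine Submodule.subset_span ⟨g * h, ?_⟩
      simp only [map_mul, Module.End.mul_apply]
    | zero => rw [map_zero]; exact Submodule.zero_mem _
    | add x y _ _ hx hy => rw [map_add]; exact Submodule.add_mem _ hx hy
    | smul a x _ hx => rw [map_smul]; exact Submodule.smul_mem _ a hx

/-- The natural map `A ⊗ M₁ → A ⊗ ℤ[Gr] = A[Gr]`, `a ⊗ m ↦ a m`. -/
def tensorMap (A : Type w) [CommRing A] (L L' : Gr F V r r') :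
    A ⊗[ℤ] (M1 L L').toSubmodule →ₗ[A] (Gr F V r r' →₀ A) :=
  LinearMap.liftBaseChange A (intMap F V r r' A ∘ₗ (M1 L L').toSubmodule.subtype)

/-- `A ⊗ M₁` viewed inside `A[Gr]`. -/
def tensorM1 (A : Type w) [CommRing A] (L L' : Gr F V r r') :
    Subrepresentation (rep F V r r' A) where
  toSubmodule := LinearMap.range (tensorMap A L L')
  apply_mem_toSubmodule g x hx := by
    obtain ⟨t, rfl⟩ := hx
    induction t using TensorProduct.induction_on with
    | zero => rw [map_zero, map_zero]; exact Submodule.zero_mem _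
    | add s t hs ht => rw [map_add, map_add]; exact Submodule.add_mem _ hs ht
    | tmul a m =>
      refine ⟨a ⊗ₜ[ℤ] ⟨_, (M1 L L').apply_mem_toSubmodule g m.2⟩, ?_⟩
      have h : (rep F V r r' A g).restrictScalars ℤ ∘ₗ intMap F V r r' A =
          intMap F V r r' A ∘ₗ rep F V r r' ℤ g := by
        ext K : 2
        simp [intMap, rep]
      have h' := LinearMap.congr_fun h m.1
      simp only [LinearMap.comp_apply, LinearMap.restrictScalars_apply] at h'
      simp [tensorMap, h']

end

/-- The representation on a subrepresentation. -/
def subRep {A : Type*} {G : Type*} {W : Type*} [CommRing A] [Group G] [AddCommGroup W]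
    [Module A W] {ρ : Representation A G W} (U : Subrepresentation ρ) :
    Representation A G U.toSubmodule :=
  U.toRepresentation

/-- The quotient of a representation by a subrepresentation. -/
def quotientRep {A : Type*} {G : Type*} {W : Type*} [CommRing A] [Group G] [AddCommGroup W]
    [Module A W] {ρ : Representation A G W} (U : Subrepresentation ρ) :
    Representation A G (W ⧸ U.toSubmodule) :=
  ρ.quotient U.toSubmodule fun g _ hx => U.apply_mem_toSubmodule g hx

end GrassmannRep

end

/-! Minimality of `K ⊗ M₁` is proved by duality. The functions `f` on the Grassmannian that
annihilate a nonzero `W` form a `G`-stable space, and over a field `[L] - [L']` lies in `W` as soon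
as `f L = f L'` for all of them. A nonzero element of `W` gives a linear relation between values of
`f`, valid after every translation by `G`. Take its alternating sum over a cube of group elements
for which the `k`-th term ignores the `k`-th parameter: only the distinguished term survives
(`altSum_smul_eq_zero`). Two such eliminations (`exists_relation_meeting`, `polyLT_shear_smul`) show
that all `f` are polynomial, of bounded degree, on the affine line of spaces between `L ∩ L'` and `L
+ L'` other than `L'`. With `L'` this is a projective line, and exchanging its two charts replaces
`x` by `x⁻¹`. Inversion is not polynomial, so only constants are possible (`const_of_polyLT`), and
`f L = f L'`.

`M₁` is spanned by the edge differences of a graph on the Grassmannian, hence is a direct summand of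
`ℤ[Gr]`; this gives injectivity after base change. Since `G` is transitive on adjacent pairs, `M₁`
is everything of degree zero exactly when adjacency connects the Grassmannian. Exchanging vectors
one at a time connects it if `r` or `r'` is finite; otherwise containment up to finite dimension
(`AlmostLE`) separates components. -/

namespace GrassmannRep

open Finset TensorProduct

universe u v w

/-! ### Alternating sums over cubes and polynomial functions -/

section CubeDiff

variable {A B ι : Type*} [AddCommMonoid A] [CommRing B]

/-- The alternating sum of a function of finite sets over the subsets of `T`. -/
def altSum {B : Type*} [Ring B] (T : Finset ι) (c : Finset ι → B) : B :=
  ∑ S ∈ T.powerset, (-1) ^ #S * c S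

theorem altSum_insert {B : Type*} [Ring B] [DecidableEq ι] {T : Finset ι} {a : ι} (ha : a ∉ T)
    (c : Finset ι → B) :
    altSum (insert a T) c = altSum T c - altSum T fun S => c (insert a S) := by
  unfold altSum
  rw [sum_powerset_insert ha, sub_eq_add_neg, ← sum_neg_distrib]
  congr 1
  refine sum_congr rfl fun S hS => ?_
  rw [card_insert_of_notMem fun h => ha (mem_powerset.1 hS h), pow_succ]
  simp

theorem altSum_congr {B : Type*} [Ring B] {T : Finset ι} {c c' : Finset ι → B}
    (h : ∀ S ⊆ T, c S = c' S) : altSum T c = altSum T c' :=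
  sum_congr rfl fun S hS => by rw [h S (mem_powerset.1 hS)]

/-- The terms of `S` and `insert a S` cancel in pairs. -/
theorem altSum_eq_zero {B : Type*} [Ring B] [DecidableEq ι] {T : Finset ι} {a : ι} (ha : a ∈ T)
    {c : Finset ι → B} (h : ∀ S ⊆ T, a ∉ S → c (insert a S) = c S) : altSum T c = 0 := by
  obtain ⟨T, haT, rfl⟩ : ∃ T', a ∉ T' ∧ insert a T' = T :=
    ⟨T.erase a, notMem_erase a T, insert_erase ha⟩
  rw [altSum_insert haT, sub_eq_zero]
  exact altSum_congr fun S hS =>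
    (h S (hS.trans (subset_insert a T)) fun h' => haT (hS h')).symm

theorem altSum_const {B : Type*} [Ring B] {T : Finset ι} (hT : T.Nonempty) (b : B) :
    altSum T (fun _ => b) = 0 := by
  classical
  obtain ⟨_, ha⟩ := hT
  exact altSum_eq_zero ha fun _ _ _ => rfl

/-- Functions killed by every `n`-fold difference operator. -/
def PolyLT {A B : Type*} [Add A] [Zero B] [Sub B] : ℕ → (A → B) → Prop
  | 0, h => ∀ x, h x = 0
  | n + 1, h => ∀ s, PolyLT n fun x => h x - h (x + s)

theorem PolyLT.succ {n : ℕ} : ∀ {h : A → B}, PolyLT n h → PolyLT (n + 1) h := by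
  induction n with
  | zero => intro h hh s x; simp only [PolyLT] at hh; simp [hh]
  | succ n ih => intro h hh s; exact ih (hh s)

theorem polyLT_of_altSum [DecidableEq ι] {T : Finset ι} : ∀ {h : A → B},
    (∀ (s : ι → A) (x : A), altSum T (fun S => h (x + ∑ i ∈ S, s i)) = 0) → PolyLT #T h := by
  induction T using Finset.induction_on with
  | empty => intro h hh x; simpa [altSum] using hh 0 x
  | insert a T ha ih =>
    intro h hh
    rw [card_insert_of_notMem ha]
    intro t
    refine ih fun s x => ?_
    rw [← hh (Function.update s a t) x, altSum_insert ha]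
    simp only [altSum, ← sum_sub_distrib, ← mul_sub]
    refine sum_congr rfl fun S hS => ?_
    have haS : a ∉ S := fun h => ha (mem_powerset.1 hS h)
    rw [sum_insert haS, sum_update_of_notMem haS, Function.update_self, add_comm t, add_assoc]

theorem PolyLT.altSum_eq_zero [DecidableEq ι] {T : Finset ι} : ∀ {h : A → B}, PolyLT #T h →
    ∀ (s : ι → A) (x : A), altSum T (fun S => h (x + ∑ i ∈ S, s i)) = 0 := by
  induction T using Finset.induction_on with
  | empty => intro h hh s x; simpa [altSum] using hh x
  | insert a T ha ih =>
    intro h hh s x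
    rw [card_insert_of_notMem ha] at hh
    rw [← ih (hh (s a)) s x, altSum_insert ha]
    simp only [altSum, ← sum_sub_distrib, ← mul_sub]
    refine sum_congr rfl fun S hS => ?_
    have haS : a ∉ S := fun h => ha (mem_powerset.1 hS h)
    rw [sum_insert haS, add_comm (s a), add_assoc]

end CubeDiff

/-! ### Inversion in a division ring is not polynomial -/

section Inverse

variable {F : Type*} [DivisionRing F] {ι : Type*}

/-- Over an infinite division ring one can choose scalars whose partial sums avoid `0`, while
the partial sums of given multiples of them avoid a given `-b ≠ 0`. -/
theorem exists_partial_sums_ne [Infinite F] [DecidableEq ι] (T : Finset ι) (c : ι → F) {b : F} (hb : b ≠ 0) :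
    ∃ s : ι → F, ∀ S ⊆ T, (S.Nonempty → ∑ i ∈ S, s i ≠ 0) ∧ b + ∑ i ∈ S, c i * s i ≠ 0 := by
  classical
  induction T using Finset.induction_on with
  | empty => exact ⟨0, fun S hS => by simp [subset_empty.1 hS, hb]⟩
  | insert a T ha ih =>
    obtain ⟨s, hs⟩ := ih
    obtain ⟨t, ht⟩ := Infinite.exists_notMem_finset
      (T.powerset.image (fun S => -∑ i ∈ S, s i) ∪
        T.powerset.image (fun S => -((c a)⁻¹ * (b + ∑ i ∈ S, c i * s i))))
    simp only [mem_union, mem_image, mem_powerset, not_or, not_exists, not_and] at ht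
    refine ⟨Function.update s a t, fun S hS => ?_⟩
    have key : ∀ S ⊆ T, ∑ i ∈ S, Function.update s a t i = ∑ i ∈ S, s i ∧
        ∑ i ∈ S, c i * Function.update s a t i = ∑ i ∈ S, c i * s i := fun S hS =>
      ⟨sum_update_of_notMem (fun h => ha (hS h)) s t, sum_congr rfl fun i hi => by
        rw [Function.update_of_ne (ne_of_mem_of_not_mem (hS hi) ha)]⟩
    by_cases haS : a ∈ S
    · obtain ⟨S, haS', rfl⟩ : ∃ S', a ∉ S' ∧ insert a S' = S :=
        ⟨S.erase a, notMem_erase a S, insert_erase haS⟩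
      have hST : S ⊆ T := fun i hi =>
        (mem_insert.1 (hS (mem_insert_of_mem hi))).resolve_left fun h => haS' (h ▸ hi)
      rw [sum_insert haS', sum_insert haS', (key S hST).1, (key S hST).2, Function.update_self]
      refine ⟨fun _ h => ht.1 S hST (eq_neg_of_add_eq_zero_left h).symm, fun h => ?_⟩
      -- If `c a = 0`, the second set of forbidden values says nothing, but then `t` does not enter
      -- the sum.
      by_cases hc : c a = 0
      · rw [hc, zero_mul, zero_add] at h
        exact (hs S hST).2 h
      · refine ht.2 S hST ?_
        have h' : c a * t = -(b + ∑ i ∈ S, c i * s i) := by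
          rw [eq_neg_iff_add_eq_zero, ← h]; abel
        rw [← mul_neg, ← h', inv_mul_cancel_left₀ hc]
    · have hST : S ⊆ T := fun i hi =>
        (mem_insert.1 (hS hi)).resolve_left fun h => haS (h ▸ hi)
      rw [(key S hST).1, (key S hST).2]
      exact hs S hST

/-- The inverse is not a polynomial function: for every order some alternating sum of inverses
does not vanish. -/
theorem exists_altSum_inv_ne_zero [Infinite F] [DecidableEq ι] {U : Finset ι} (hUne : U.Nonempty) :
    ∃ j ∈ U, ∃ y : ι → F, (∀ S ⊆ U.erase j, y j + ∑ i ∈ S, y i ≠ 0) ∧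
      altSum (U.erase j) (fun S => (y j + ∑ i ∈ S, y i)⁻¹) ≠ 0 := by
  obtain ⟨y, hy⟩ := exists_partial_sums_ne U (0 : ι → F) one_ne_zero
  by_contra! hcon
  have hne : ∀ j ∈ U, ∀ S ⊆ U.erase j, y j + ∑ i ∈ S, y i ≠ 0 := by
    intro j hj S hS
    have hjS : j ∉ S := fun h => notMem_erase j _ (hS h)
    rw [← sum_insert hjS]
    exact (hy _ (insert_subset hj (hS.trans (erase_subset _ _)))).1 (insert_nonempty j S)
  have h0 := fun j hj => hcon j hj y (hne j hj)
  -- The product is `1` except at `S = ∅`, where it is `0`. Expanding the first factor over `j`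
  -- instead writes the same sum through the alternating sums that were assumed to vanish.
  have e1 : altSum U (fun S => (∑ j ∈ S, y j) * (∑ i ∈ S, y i)⁻¹) = -1 := by
    rw [← zero_sub, ← altSum_const (B := F) hUne 1]
    unfold altSum
    rw [← add_sum_erase _ _ (empty_mem_powerset U), ← add_sum_erase _ _ (empty_mem_powerset U)]
    simp only [sum_empty, inv_zero, mul_zero, zero_add, card_empty, pow_zero, mul_one,
      add_sub_cancel_left]
    refine sum_congr rfl fun S hS => ?_
    rw [mem_erase, mem_powerset] at hS
    rw [mul_inv_cancel₀ ((hy S hS.2).1 (nonempty_iff_ne_empty.2 hS.1)), mul_one]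
  have e2 : altSum U (fun S => (∑ j ∈ S, y j) * (∑ i ∈ S, y i)⁻¹) =
      ∑ j ∈ U, altSum U (fun S => if j ∈ S then y j * (∑ i ∈ S, y i)⁻¹ else 0) := by
    unfold altSum
    rw [sum_comm]
    refine sum_congr rfl fun S hS => ?_
    dsimp only
    rw [← mul_sum, sum_mul, ← sum_filter, filter_mem_eq_inter,
      inter_eq_right.2 (mem_powerset.1 hS)]
  have e3 : ∀ j ∈ U, altSum U (fun S => if j ∈ S then y j * (∑ i ∈ S, y i)⁻¹ else 0) = 0 := by
    intro j hj
    have hj' := notMem_erase j U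
    conv_lhs => rw [← insert_erase hj]
    rw [altSum_insert hj']
    have a1 : altSum (U.erase j) (fun S => if j ∈ S then y j * (∑ i ∈ S, y i)⁻¹ else 0) = 0 :=
      sum_eq_zero fun S hS => by
        dsimp only
        rw [if_neg fun h => hj' (mem_powerset.1 hS h), mul_zero]
    have a2 : altSum (U.erase j) (fun S => if j ∈ insert j S then
        y j * (∑ i ∈ insert j S, y i)⁻¹ else 0) =
        y j * altSum (U.erase j) (fun S => (y j + ∑ i ∈ S, y i)⁻¹) := by
      unfold altSum
      rw [mul_sum]
      refine sum_congr rfl fun S hS => ?_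
      dsimp only
      rw [if_pos (mem_insert_self j S), sum_insert fun h => hj' (mem_powerset.1 hS h)]
      simp only [← mul_assoc]
      rw [((Commute.neg_one_left (y j)).pow_left _).eq]
    rw [a1, a2, h0 j hj, mul_zero, sub_zero]
  rw [e2, sum_eq_zero e3] at e1
  exact one_ne_zero (neg_eq_zero.1 e1.symm)

variable {K : Type*} [CommRing K]

theorem map_altSum (φ : F →+ K) (T : Finset ι) (c : Finset ι → F) :
    φ (altSum T c) = altSum T fun S => φ (c S) := by
  unfold altSum
  rw [map_sum]
  refine sum_congr rfl fun S _ => ?_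
  rcases neg_one_pow_eq_or F #S with h | h <;> rcases Nat.even_or_odd #S with h' | h' <;>
    simp [h'.neg_one_pow]

/-- An additive function whose composition with the inverse is polynomial vanishes. -/
theorem addMonoidHom_eq_zero_of_polyLT_inv [Infinite F] (φ : F →+ K) (b : K) {N : ℕ} {q : F → K}
    (hq : PolyLT (N + 1) q) (h : ∀ x, x ≠ 0 → φ x⁻¹ + b = q x) : φ = 0 := by
  obtain ⟨j, hj, y, hy, hw⟩ := exists_altSum_inv_ne_zero (F := F)
    (nonempty_range_iff.2 (Nat.succ_ne_zero (N + 1)))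
  generalize hU : (range (N + 1).succ).erase j = U at *
  have hcard : #U = N + 1 := by
    rw [← hU, card_erase_of_mem hj, card_range]
    rfl
  have hUne : U.Nonempty := card_pos.1 (hcard ▸ Nat.succ_pos N)
  generalize hw' : altSum U (fun S => (y j + ∑ i ∈ S, y i)⁻¹) = w at *
  have key : ∀ a : F, a ≠ 0 → φ (w * a) = 0 := by
    intro a ha
    -- Scaling the cube by `a⁻¹` on the left multiplies the inverses by `a` on the right, so `w * a`
    -- runs through all nonzero elements.
    have e : w * a = altSum U fun S => (a⁻¹ * y j + ∑ i ∈ S, a⁻¹ * y i)⁻¹ := by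
      rw [← hw']
      unfold altSum
      rw [sum_mul]
      refine sum_congr rfl fun S _ => ?_
      dsimp only
      rw [← mul_sum, ← mul_add, mul_inv_rev, inv_inv, mul_assoc]
    rw [e, map_altSum]
    have e' : altSum U (fun S => φ (a⁻¹ * y j + ∑ i ∈ S, a⁻¹ * y i)⁻¹) +
        altSum U (fun _ => b) = altSum U (fun S => q (a⁻¹ * y j + ∑ i ∈ S, a⁻¹ * y i)) := by
      unfold altSum
      rw [← sum_add_distrib]
      refine sum_congr rfl fun S hS => ?_
      rw [← mul_add, h]
      rw [← mul_sum, ← mul_add]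
      exact mul_ne_zero (inv_ne_zero ha) (hy S (mem_powerset.1 hS))
    rw [altSum_const hUne, add_zero] at e'
    rw [e']
    exact PolyLT.altSum_eq_zero (hcard ▸ hq) (fun i => a⁻¹ * y i) _
  ext x
  by_cases hx : x = 0
  · rw [hx, map_zero, map_zero]
  · rw [← mul_inv_cancel_left₀ hw x]
    exact key _ (mul_ne_zero (inv_ne_zero hw) hx)

/-- A space of functions on the affine line that is closed under differences and under passing
to the other chart of the projective line, and that consists of polynomial functions of bounded
degree, consists of constants. -/
theorem const_of_polyLT [Infinite F] {Q : Set (F → K)}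
    (hdiff : ∀ q ∈ Q, ∀ s, (fun x => q x - q (x + s)) ∈ Q)
    (hinv : ∀ q ∈ Q, ∃ q' ∈ Q, ∀ x, x ≠ 0 → q x⁻¹ = q' x)
    {N : ℕ} (hN : ∀ q ∈ Q, PolyLT N q) {q : F → K} (hq : q ∈ Q) (x : F) : q x = q 0 := by
  have step : ∀ m, ∀ q ∈ Q, PolyLT (m + 2) q → PolyLT (m + 1) q := by
    intro m
    induction m with
    | succ m ih => exact fun q hq h s => ih _ (hdiff q hq s) (h s)
    -- Degree at most one: `q - q 0` is additive, and the other chart makes its composition with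
    -- inversion polynomial.
    | zero =>
      intro q hq h
      obtain ⟨q', hq', hqq'⟩ := hinv q hq
      have hadd : ∀ s t, q (s + t) - q 0 = q s - q 0 + (q t - q 0) := by
        intro s t
        have := h s t 0
        simp only [zero_add] at this
        rw [add_comm s t]
        linear_combination this
      have hφ := addMonoidHom_eq_zero_of_polyLT_inv
        (φ := { toFun := fun x => q x - q 0, map_zero' := sub_self _, map_add' := hadd })
        (b := q 0) (hN q' hq').succ fun x hx => by
          rw [← hqq' x hx]
          exact sub_add_cancel _ _
      intro s x
      have hx : ∀ x, q x = q 0 := fun x => sub_eq_zero.1 (DFunLike.congr_fun hφ x)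
      simp only [hx x, hx (x + s), sub_self]
  have down : ∀ n, (∀ q ∈ Q, PolyLT (n + 1) q) → ∀ q ∈ Q, PolyLT 1 q := by
    intro n
    induction n with
    | zero => exact id
    | succ n ih => exact fun h => ih fun q hq => step n q hq (h q hq)
  have h1 := down N (fun q hq => (hN q hq).succ) q hq x 0
  simp only [zero_add] at h1
  exact (sub_eq_zero.1 h1).symm

end Inverse

/-! ### Adjacent spaces, exchanges and pencils -/

section Geometry

variable {F : Type u} {V : Type v} [DivisionRing F] [AddCommGroup V] [Module F V]
  {r r' : Cardinal.{v}}

theorem mem_smul_iff (g : V ≃ₗ[F] V) (L : Gr F V r r') (x : V) :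
    x ∈ (g • L).1 ↔ ∃ y ∈ L.1, g y = x :=
  Submodule.mem_map

theorem mem_inv_smul_iff (g : V ≃ₗ[F] V) (L : Gr F V r r') (x : V) :
    x ∈ (g⁻¹ • L).1 ↔ g x ∈ L.1 := by
  rw [mem_smul_iff]
  constructor
  · rintro ⟨y, hy, rfl⟩
    exact (g.apply_symm_apply y).symm ▸ hy
  · exact fun h => ⟨g x, h, g.symm_apply_apply x⟩

theorem smul_eq_smul_of_eqOn {g h : V ≃ₗ[F] V} {L : Gr F V r r'} (hgh : ∀ x ∈ L.1, g x = h x) :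
    g • L = h • L := by
  refine Subtype.ext (Submodule.ext fun x => ?_)
  rw [mem_smul_iff, mem_smul_iff]
  exact exists_congr fun y => and_congr_right fun hy => by rw [hgh y hy]

theorem smul_le_smul_iff (g : V ≃ₗ[F] V) (L M : Gr F V r r') :
    (g • L).1 ≤ (g • M).1 ↔ L.1 ≤ M.1 :=
  Submodule.map_le_map_iff_of_injective g.injective _ _

theorem exists_smul_eq (L M : Gr F V r r') : ∃ g : V ≃ₗ[F] V, g • L = M := by
  obtain ⟨P, hP⟩ := L.1.exists_isCompl
  obtain ⟨Q, hQ⟩ := M.1.exists_isCompl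
  obtain ⟨a⟩ := nonempty_linearEquiv_of_rank_eq (L.2.1.trans M.2.1.symm)
  obtain ⟨b⟩ := nonempty_linearEquiv_of_rank_eq
    (((Submodule.quotientEquivOfIsCompl _ _ hP).rank_eq.symm.trans (L.2.2.trans M.2.2.symm)).trans
      (Submodule.quotientEquivOfIsCompl _ _ hQ).rank_eq)
  let g : V ≃ₗ[F] V := (Submodule.prodEquivOfIsCompl _ _ hP).symm ≪≫ₗ
    (a.prodCongr b) ≪≫ₗ Submodule.prodEquivOfIsCompl _ _ hQ
  have hg : ∀ x : L.1, g x = a x := by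
    intro x
    simp [g]
  refine ⟨g, Subtype.ext (Submodule.ext fun x => ?_)⟩
  rw [mem_smul_iff]
  constructor
  · rintro ⟨y, hy, rfl⟩
    rw [hg ⟨y, hy⟩]
    exact (a ⟨y, hy⟩).2
  · intro hx
    refine ⟨a.symm ⟨x, hx⟩, (a.symm ⟨x, hx⟩).2, ?_⟩
    rw [hg, a.apply_symm_apply]

theorem exists_transvection {φ : Module.Dual F V} {w : V} (h : 1 + φ w ≠ 0) :
    ∃ g : V ≃ₗ[F] V, ∀ u, g u = u + φ u • w :=
  ⟨LinearEquiv.dilatransvection (isUnit_iff_ne_zero.2 h), fun _ => rfl⟩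

theorem rank_quotient_submoduleOf_eq_one_iff {M N : Submodule F V} :
    Module.rank F (M ⧸ N.submoduleOf M) = 1 ↔
      ∃ e ∈ M, e ∉ N ∧ ∀ u ∈ M, ∃ a : F, u - a • e ∈ N := by
  rw [rank_eq_one_iff]
  constructor
  · rintro ⟨q, hq, h⟩
    obtain ⟨e, rfl⟩ := Submodule.Quotient.mk_surjective _ q
    refine ⟨e, e.2, fun he => hq ((Submodule.Quotient.mk_eq_zero _).2 he), fun u hu => ?_⟩
    obtain ⟨a, ha⟩ := h (Submodule.Quotient.mk ⟨u, hu⟩)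
    exact ⟨a, (Submodule.Quotient.eq (N.submoduleOf M)).1 ha.symm⟩
  · rintro ⟨e, he, heN, h⟩
    refine ⟨Submodule.Quotient.mk ⟨e, he⟩,
      fun h0 => heN ((Submodule.Quotient.mk_eq_zero (N.submoduleOf M)).1 h0), fun q => ?_⟩
    obtain ⟨u, rfl⟩ := Submodule.Quotient.mk_surjective _ q
    obtain ⟨a, ha⟩ := h u u.2
    exact ⟨a, ((Submodule.Quotient.eq (N.submoduleOf M)).2 ha).symm⟩

/-- `L'` arises from `L` by exchanging a vector `e` against `v`; here `φ` is a linear form with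
`φ e = 1` and `φ v = 0`. -/
structure Exchange (L L' : Gr F V r r') (e v : V) (φ : Module.Dual F V) : Prop where
  mem : e ∈ L.1
  notMem : v ∉ L.1
  apply_mem : φ e = 1
  apply_notMem : φ v = 0
  eq : L'.1 = (L.1 ⊓ LinearMap.ker φ) ⊔ Submodule.span F {v}

theorem Adjacent.exists_exchange {L L' : Gr F V r r'} (h : Adjacent L L') :
    ∃ e v φ, Exchange L L' e v φ := by
  obtain ⟨h1, h2⟩ := h
  rw [rank_quotient_submoduleOf_eq_one_iff] at h1 h2
  obtain ⟨e, heL, he, hL⟩ := h1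
  obtain ⟨v, hvL', hv, hL'⟩ := h2
  have heL' : e ∉ L'.1 := fun h => he ⟨heL, h⟩
  -- As `φ` vanishes on all of `L'`, its kernel cuts `L` exactly in `L ∩ L'`.
  obtain ⟨φ, hφ, hφe⟩ := LinearMap.exists_extend_of_notMem (0 : L'.1 →ₗ[F] F) heL' 1
  have hφ' : ∀ u ∈ L'.1, φ u = 0 := fun u hu => LinearMap.congr_fun hφ ⟨u, hu⟩
  refine ⟨e, v, φ, heL, fun h => hv ⟨h, hvL'⟩, hφe, hφ' v hvL', le_antisymm ?_ ?_⟩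
  · intro u hu
    obtain ⟨a, ha⟩ := hL' u hu
    rw [← sub_add_cancel u (a • v)]
    exact Submodule.add_mem_sup ⟨ha.1, hφ' _ ha.2⟩
      (Submodule.smul_mem _ a (Submodule.mem_span_singleton_self v))
  · refine sup_le ?_ (by simpa using hvL')
    rintro u ⟨hu, hφu⟩
    obtain ⟨a, ha⟩ := hL u hu
    have h0 := hφ' _ ha.2
    rw [map_sub, LinearMap.mem_ker.1 hφu, map_smul, hφe, smul_eq_mul, mul_one, zero_sub,
      neg_eq_zero] at h0
    rw [h0, zero_smul, sub_zero] at ha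
    exact ha.2

theorem Exchange.adjacent {L L' : Gr F V r r'} {e v : V} {φ : Module.Dual F V}
    (h : Exchange L L' e v φ) : Adjacent L L' := by
  have hv : v ∈ L'.1 := h.eq ▸ Submodule.mem_sup_right (Submodule.mem_span_singleton_self v)
  have hD : ∀ u ∈ L.1, φ u = 0 → u ∈ L.1 ⊓ L'.1 := fun u hu hφu =>
    ⟨hu, h.eq ▸ Submodule.mem_sup_left ⟨hu, hφu⟩⟩
  have hφ : ∀ u ∈ L'.1, φ u = 0 ∧ ∃ a : F, u - a • v ∈ L.1 ⊓ L'.1 := by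
    intro u hu
    rw [h.eq] at hu
    obtain ⟨d, hd, z, hz, rfl⟩ := Submodule.mem_sup.1 hu
    obtain ⟨a, rfl⟩ := Submodule.mem_span_singleton.1 hz
    refine ⟨by rw [map_add, map_smul, h.apply_notMem, LinearMap.mem_ker.1 hd.2]; simp, a, ?_⟩
    rw [add_sub_cancel_right]
    exact hD d hd.1 hd.2
  rw [Adjacent, rank_quotient_submoduleOf_eq_one_iff, rank_quotient_submoduleOf_eq_one_iff]
  refine ⟨⟨e, h.mem, fun he => ?_, fun u hu => ⟨φ u, hD _ ?_ ?_⟩⟩,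
    ⟨v, hv, fun hv' => h.notMem hv'.1, fun u hu => (hφ u hu).2⟩⟩
  · exact one_ne_zero (h.apply_mem ▸ (hφ e he.2).1)
  · exact sub_mem hu (Submodule.smul_mem _ _ h.mem)
  · rw [map_sub, map_smul, h.apply_mem, smul_eq_mul, mul_one, sub_self]

theorem Adjacent.ne {L L' : Gr F V r r'} (h : Adjacent L L') : L ≠ L' := by
  obtain ⟨e, v, φ, hE⟩ := h.exists_exchange
  rintro rfl
  exact hE.notMem (hE.eq ▸ Submodule.mem_sup_right (Submodule.mem_span_singleton_self v))

/-- The one-parameter group of transvections `u ↦ u + φ(u) x v`. -/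
def shear (φ : Module.Dual F V) {v : V} (h : φ v = 0) (x : F) : V ≃ₗ[F] V :=
  LinearEquiv.transvection (f := φ) (v := x • v) (by rw [map_smul, h, smul_zero])

theorem shear_apply (φ : Module.Dual F V) {v : V} (h : φ v = 0) (x : F) (u : V) :
    shear φ h x u = u + φ u • x • v := rfl

theorem shear_add (φ : Module.Dual F V) {v : V} (h : φ v = 0) (x y : F) :
    shear φ h (x + y) = shear φ h x * shear φ h y := by
  ext u
  simp [shear_apply, h, add_smul, add_comm, add_left_comm]

theorem shear_zero (φ : Module.Dual F V) {v : V} (h : φ v = 0) : shear φ h 0 = 1 := by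
  ext u
  simp [shear_apply]

theorem shear_neg (φ : Module.Dual F V) {v : V} (h : φ v = 0) (x : F) :
    shear φ h (-x) = (shear φ h x)⁻¹ := by
  rw [eq_inv_iff_mul_eq_one, ← shear_add, neg_add_cancel, shear_zero]

/-- The involution that exchanges `e` and `v` interchanges the two charts of the pencil. -/
theorem Exchange.exists_swap {L L' : Gr F V r r'} {e v : V} {φ : Module.Dual F V}
    (h : Exchange L L' e v φ) : ∃ t : V ≃ₗ[F] V, t • L = L' ∧
      ∀ x : F, x ≠ 0 → t • shear φ h.apply_notMem x • L = shear φ h.apply_notMem x⁻¹ • L := by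
  obtain ⟨ψ, hψ, hψv⟩ := LinearMap.exists_extend_of_notMem (0 : L.1 →ₗ[F] F) h.notMem 1
  have hψL : ∀ u ∈ L.1, ψ u = 0 := fun u hu => LinearMap.congr_fun hψ ⟨u, hu⟩
  have hψe := hψL e h.mem
  have hφe := h.apply_mem
  have hφv := h.apply_notMem
  -- Here `(φ - ψ) (v - e) = -2`, so `1 + (-2) = -1` is nonzero in every characteristic.
  obtain ⟨t, ht⟩ := exists_transvection (φ := φ - ψ) (w := v - e) (by simp [*])
  have htt : t * t = 1 := by
    ext u
    have : (φ - ψ) (v - e) = -2 := by simp [*]; norm_num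
    change t (t u) = u
    rw [ht (t u), ht u, map_add, map_smul, this, smul_eq_mul, mul_neg, add_smul, neg_smul, mul_two,
      add_smul]
    abel
  refine ⟨t, Subtype.ext (le_antisymm ?_ ?_), ?_⟩
  · intro x hx
    obtain ⟨u, hu, rfl⟩ := (mem_smul_iff _ _ _).1 hx
    rw [h.eq]
    have e1 : t u = (u - φ u • e) + φ u • v := by
      rw [ht, LinearMap.sub_apply, hψL u hu, sub_zero, smul_sub]
      abel
    rw [e1]
    refine Submodule.add_mem_sup ⟨sub_mem hu (Submodule.smul_mem _ _ h.mem), ?_⟩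
      (Submodule.smul_mem _ _ (Submodule.mem_span_singleton_self v))
    simp [hφe]
  · rw [h.eq]
    refine sup_le (fun u hu => (mem_smul_iff _ _ _).2 ⟨u, hu.1, ?_⟩) ?_
    · rw [ht, LinearMap.sub_apply, hψL u hu.1, LinearMap.mem_ker.1 hu.2]
      simp
    · rw [Submodule.span_singleton_le_iff_mem]
      exact (mem_smul_iff _ _ _).2 ⟨e, h.mem, by rw [ht, LinearMap.sub_apply, hφe, hψe]; simp⟩
  · have key : ∀ x : F, x ≠ 0 → (t • shear φ hφv x • L).1 ≤ (shear φ hφv x⁻¹ • L).1 := by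
      intro x hx z hz
      obtain ⟨y, hy, rfl⟩ := (mem_smul_iff _ _ _).1 hz
      obtain ⟨u, hu, rfl⟩ := (mem_smul_iff _ _ _).1 hy
      rw [← inv_inv (shear φ hφv x⁻¹), mem_inv_smul_iff, ← shear_neg]
      have e1 : shear φ hφv (-x⁻¹) (t (shear φ hφv x u)) = u + (φ u * x - φ u) • e := by
        have e2 : t (shear φ hφv x u) = u + φ u • x • v + (φ u - φ u * x) • (v - e) := by
          rw [ht, shear_apply]
          simp [hφv, hψv, hψL u hu]
        have e3 : φ (t (shear φ hφv x u)) = φ u * x := by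
          rw [e2]
          simp [hφv, hφe]
        rw [shear_apply, e3, e2, smul_smul (φ u * x), mul_neg, mul_inv_cancel_right₀ hx,
          smul_smul]
        simp only [sub_smul, smul_sub, neg_smul]
        abel
      rw [e1]
      exact add_mem hu (Submodule.smul_mem _ _ h.mem)
    intro x hx
    refine Subtype.ext (le_antisymm (key x hx) ?_)
    have := key x⁻¹ (inv_ne_zero hx)
    rw [inv_inv, ← smul_le_smul_iff t, ← mul_smul, htt, one_smul] at this
    exact this

end Geometry

/-! ### Elimination by alternating sums -/

section Elimination

variable {G X K κ : Type*} [Group G] [MulAction G X] [CommRing K] [DecidableEq κ]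

/-- If the `k`-th term of a relation does not see the `k`-th parameter, then the alternating sum
over all parameters leaves only the distinguished term. -/
theorem altSum_smul_eq_zero {f : X → K} {c : K} {b : κ → K} {x₀ : X} {x : κ → X}
    {T : Finset κ} (hf : ∀ g : G, c * f (g • x₀) + ∑ k ∈ T, b k * f (g • x k) = 0)
    {g : Finset κ → G}
    (hg : ∀ k ∈ T, ∀ S ⊆ T, k ∉ S → g (insert k S) • x k = g S • x k) :
    c * altSum T (fun S => f (g S • x₀)) = 0 := by
  have e1 : ∀ k ∈ T, altSum T (fun S => f (g S • x k)) = 0 := fun k hk =>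
    altSum_eq_zero hk fun S hS hkS => by rw [hg k hk S hS hkS]
  have e2 : c * altSum T (fun S => f (g S • x₀)) +
      ∑ k ∈ T, b k * altSum T (fun S => f (g S • x k)) = 0 := by
    simp only [altSum, mul_sum]
    rw [sum_comm, ← sum_add_distrib]
    refine sum_eq_zero fun S _ => ?_
    rw [← mul_zero ((-1) ^ #S), ← hf (g S), mul_add, mul_sum]
    congr 1
    · ring
    · exact sum_congr rfl fun k _ => by ring
  rwa [sum_eq_zero fun k hk => by rw [e1 k hk, mul_zero], add_zero] at e2

end Elimination

/-! ### Annihilating functions are constant on pencils -/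

section Main

variable {F : Type u} {V : Type v} [DivisionRing F] [AddCommGroup V] [Module F V]
  {r r' : Cardinal.{v}} {K : Type w} [CommRing K] {κ : Type*}

/-- Over an infinite division ring, `L` is not a finite union of proper subspaces. -/
theorem exists_mem_forall_notMem [Infinite F] (L : Submodule F V) {T : Finset κ} {M : κ → Submodule F V}
    (h : ∀ k ∈ T, ¬ L ≤ M k) : ∃ e ∈ L, ∀ k ∈ T, e ∉ M k := by
  classical
  by_contra! hcon
  have : (⊤ : Submodule F L) ∈ T.image fun k => (M k).submoduleOf L := by
    refine Subspace.top_mem_of_biUnion_eq_univ (Set.eq_univ_of_forall fun e => ?_)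
    obtain ⟨k, hk, hek⟩ := hcon e e.2
    simp only [mem_image, Set.iUnion_exists, Set.mem_iUnion]
    exact ⟨_, k, ⟨hk, rfl⟩, hek⟩
  obtain ⟨k, hk, hek⟩ := mem_image.1 this
  exact h k hk (Submodule.submoduleOf_eq_top.1 hek)

/-- From a relation whose distinguished term `L` is not contained in the other terms one gets a
relation between `L` and spaces that meet `v + L`. -/
theorem exists_relation_meeting [Infinite F] {L : Gr F V r r'} (v : V)
    {T : Finset κ} {x : κ → Gr F V r r'} (hx : ∀ k ∈ T, ¬ L.1 ≤ (x k).1) (c : K) :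
    ∃ (T' : Finset (Finset κ)) (b' : Finset κ → K) (x' : Finset κ → Gr F V r r'),
      (∀ k ∈ T', ∃ u ∈ (x' k).1, u - v ∈ L.1) ∧
      ∀ (f : Gr F V r r' → K) (b : κ → K), (∀ g : V ≃ₗ[F] V,
        c * f (g • L) + ∑ k ∈ T, b k * f (g • x k) = 0) →
        ∀ g : V ≃ₗ[F] V, c * f (g • L) + ∑ k ∈ T', b' k * f (g • x' k) = 0 := by
  classical
  obtain ⟨e, heL, he⟩ := exists_mem_forall_notMem L.1 hx
  have hφ : ∀ k, ∃ φ : Module.Dual F V, k ∈ T → (∀ u ∈ (x k).1, φ u = 0) ∧ φ e = 1 := by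
    intro k
    by_cases hk : k ∈ T
    · obtain ⟨φ, h1, h2⟩ := LinearMap.exists_extend_of_notMem (0 : (x k).1 →ₗ[F] F) (he k hk) 1
      exact ⟨φ, fun _ => ⟨fun u hu => LinearMap.congr_fun h1 ⟨u, hu⟩, h2⟩⟩
    · exact ⟨0, fun h => absurd h hk⟩
  choose φ hφ using hφ
  -- One condition makes `g S` invertible, the other makes `g S e - e` a nonzero multiple of `v`.
  obtain ⟨s, hs⟩ := exists_partial_sums_ne T (fun k => φ k v) (one_ne_zero (α := F))
  let Φ : Finset κ → Module.Dual F V := fun S =>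
    ∑ k ∈ S, LinearMap.toSpanSingleton F F (s k) ∘ₗ φ k
  have hΦ : ∀ S u, Φ S u = ∑ k ∈ S, φ k u * s k := fun S u => by simp [Φ]
  have hg : ∀ S, ∃ g : V ≃ₗ[F] V, S ⊆ T → ∀ u, g u = u + Φ S u • v := by
    intro S
    by_cases hS : S ⊆ T
    · obtain ⟨g, hg⟩ := exists_transvection (φ := Φ S) (w := v) (hΦ S v ▸ (hs S hS).2)
      exact ⟨g, fun _ => hg⟩
    · exact ⟨1, fun h => absurd h hS⟩
  choose g hg using hg
  have hg0 : g ∅ = 1 := by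
    ext u
    rw [hg ∅ (empty_subset T), hΦ]
    simp
  refine ⟨T.powerset.erase ∅, fun S => c * (-1) ^ #S, fun S => g S • L, fun S hS => ?_,
    fun f b hf h => ?_⟩
  · rw [mem_erase, mem_powerset] at hS
    have hne := (hs S hS.2).1 (nonempty_iff_ne_empty.2 hS.1)
    refine ⟨(∑ k ∈ S, s k)⁻¹ • g S e, Submodule.smul_mem _ _
      ((mem_smul_iff _ _ _).2 ⟨e, heL, rfl⟩), ?_⟩
    have : Φ S e = ∑ k ∈ S, s k := by
      rw [hΦ]
      exact sum_congr rfl fun k hk => by rw [(hφ k (hS.2 hk)).2, one_mul]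
    rw [hg S hS.2, this, smul_add, inv_smul_smul₀ hne, add_sub_cancel_right]
    exact Submodule.smul_mem _ _ heL
  -- The form `φ k` vanishes on `x k`, so `g S • x k` does not depend on whether `k ∈ S`.
  · have key := altSum_smul_eq_zero (f := fun M => f (h • M)) (g := g)
      (fun g => by simpa only [mul_smul] using hf (h * g)) (fun k hk S hS hkS =>
        smul_eq_smul_of_eqOn fun u hu => by
          rw [hg _ (insert_subset hk hS), hg _ hS, hΦ, hΦ, sum_insert hkS, (hφ k hk).1 u hu,
            zero_mul, zero_add])
    rw [altSum, ← add_sum_erase _ _ (empty_mem_powerset T), hg0] at key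
    rw [← key, mul_add, mul_sum]
    simp [mul_assoc]

/-- A relation between `L` and spaces that meet `v + L` makes functions on the pencil through `L`
in the direction of `v` polynomial. -/
theorem polyLT_shear_smul [Infinite F] [IsDomain K] {L : Gr F V r r'} {e v : V} {φ : Module.Dual F V}
    (he : e ∈ L.1) (hφe : φ e = 1) (hφv : φ v = 0) {c : K} (hc : c ≠ 0) {b : κ → K}
    {T : Finset κ} {x : κ → Gr F V r r'} (hx : ∀ k ∈ T, ∃ u ∈ (x k).1, u - v ∈ L.1)
    {f : Gr F V r r' → K}
    (hf : ∀ g : V ≃ₗ[F] V, c * f (g • L) + ∑ k ∈ T, b k * f (g • x k) = 0) :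
    PolyLT #T fun a : F => f (shear φ hφv a • L) := by
  classical
  have hu : ∀ k, ∃ u : V, k ∈ T → u ∈ (x k).1 ∧ u - v ∈ L.1 := by
    intro k
    by_cases hk : k ∈ T
    · obtain ⟨u, hu⟩ := hx k hk
      exact ⟨u, fun _ => hu⟩
    · exact ⟨0, fun h => absurd h hk⟩
  choose u hu using hu
  refine polyLT_of_altSum fun s a => ?_
  -- The summand `η • e` of `w S` only serves to make `g S` invertible; it does not affect the image
  -- of `L`, as `e ∈ L`.
  obtain ⟨η, hη⟩ := Infinite.exists_notMem_finset
    (T.powerset.image fun S => -(1 - ∑ k ∈ S, s k * φ (u k)))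
  let w : Finset κ → V := fun S => η • e - ∑ k ∈ S, s k • u k
  have hg : ∀ S, ∃ g : V ≃ₗ[F] V, S ⊆ T → ∀ y, g y = y + φ y • w S := by
    intro S
    by_cases hS : S ⊆ T
    · obtain ⟨g, hg⟩ := exists_transvection (φ := φ) (w := w S) (by
        intro h
        refine hη (mem_image.2 ⟨S, mem_powerset.2 hS, ?_⟩)
        simp only [w, map_sub, map_smul, hφe, smul_eq_mul, mul_one, map_sum] at h
        rw [neg_eq_iff_add_eq_zero, ← h]
        abel)
      exact ⟨g, fun _ => hg⟩
    · exact ⟨1, fun h => absurd h hS⟩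
  choose g hg using hg
  -- Inverses are used because membership in `(g S)⁻¹ • x k` is tested on `g S y`, where multiples
  -- of `u k ∈ x k` are invisible. Modulo `L` each `u k` is `v`, so `(g S)⁻¹` moves `L` as the shear
  -- by `∑ k ∈ S, s k` does.
  have key := altSum_smul_eq_zero (f := fun M => f (shear φ hφv a • M)) (g := fun S => (g S)⁻¹)
    (fun g => by simpa only [mul_smul] using hf (shear φ hφv a * g)) (fun k hk S hS hkS => by
      refine Subtype.ext (Submodule.ext fun y => ?_)
      rw [mem_inv_smul_iff, mem_inv_smul_iff, hg _ (insert_subset hk hS), hg _ hS]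
      have : y + φ y • w (insert k S) = y + φ y • w S - (φ y * s k) • u k := by
        simp only [w, sum_insert hkS, smul_sub, smul_add, mul_smul]
        abel
      rw [this]
      exact Submodule.sub_mem_iff_left _ (Submodule.smul_mem _ _ (hu k hk).1))
  rw [← (mul_eq_zero.1 key).resolve_left hc]
  refine altSum_congr fun S hS => ?_
  rw [shear_add, mul_smul]
  congr 2
  refine Subtype.ext (Submodule.ext fun y => ?_)
  rw [← inv_inv (shear φ hφv (∑ k ∈ S, s k)), mem_inv_smul_iff, mem_inv_smul_iff, hg _ hS,
    ← shear_neg, shear_apply]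
  have : y + φ y • w S = y + φ y • (-∑ k ∈ S, s k) • v +
      φ y • (η • e - ∑ k ∈ S, s k • (u k - v)) := by
    simp only [w, smul_sub, sum_sub_distrib, neg_smul, sum_smul, smul_neg]
    abel
  rw [this]
  refine (Submodule.add_mem_iff_left _ (Submodule.smul_mem _ _ (sub_mem
    (Submodule.smul_mem _ _ he) (sum_mem fun k hk => Submodule.smul_mem _ _ ?_)))).symm
  exact (hu k (hS hk)).2

/-- The functions on the Grassmannian that annihilate a subrepresentation. -/
def Annihilates (W : Subrepresentation (rep F V r r' K)) (f : Gr F V r r' → K) : Prop :=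
  ∀ α ∈ W.toSubmodule, Finsupp.linearCombination K f α = 0

theorem Annihilates.smul {W : Subrepresentation (rep F V r r' K)} {f : Gr F V r r' → K}
    (h : Annihilates W f) (g : V ≃ₗ[F] V) : Annihilates W fun L => f (g • L) := by
  intro α hα
  rw [← h _ (W.apply_mem_toSubmodule g hα)]
  exact (Finsupp.linearCombination_mapDomain K (v' := f) (f := fun L => g • L) α).symm

theorem Annihilates.sub {W : Subrepresentation (rep F V r r' K)} {f f' : Gr F V r r' → K}
    (h : Annihilates W f) (h' : Annihilates W f') : Annihilates W fun L => f L - f' L := by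
  intro α hα
  have e := sub_eq_zero.2 ((h α hα).trans (h' α hα).symm)
  rw [Finsupp.linearCombination_apply, Finsupp.linearCombination_apply, ← Finsupp.sum_sub] at e
  rw [Finsupp.linearCombination_apply]
  simpa only [smul_sub] using e

/-- An inclusion-maximal space in the support of a nonzero element of `W` can be moved to `L` and
serves as distinguished term. The bound `N` depends on this element but not on `f`. -/
theorem exists_polyLT [Infinite F] [IsDomain K] {W : Subrepresentation (rep F V r r' K)} (hW : W ≠ ⊥)
    {L L' : Gr F V r r'} {e v : V} {φ : Module.Dual F V} (h : Exchange L L' e v φ) :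
    ∃ N, ∀ f, Annihilates W f →
      PolyLT N fun a : F => f (shear φ h.apply_notMem a • L) := by
  classical
  obtain ⟨α, hα, hα0⟩ : ∃ α ∈ W.toSubmodule, α ≠ 0 := by
    refine (Submodule.ne_bot_iff _).1 fun h => hW ?_
    exact Subrepresentation.toSubmodule_injective h
  obtain ⟨M, hM, hmax⟩ := α.support.exists_maximalFor (fun M : Gr F V r r' => M.1)
    (Finsupp.support_nonempty_iff.2 hα0)
  obtain ⟨g₀, rfl⟩ := exists_smul_eq M L
  obtain ⟨T, b, x, hx, hrel⟩ := exists_relation_meeting v (T := α.support.erase M)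
    (x := fun N => g₀ • N) (fun N hN hle => by
      rw [mem_erase] at hN
      rw [smul_le_smul_iff] at hle
      exact hN.1 (Subtype.ext (le_antisymm (hmax hN.2 hle) hle))) (α M)
  refine ⟨#T, fun f hf => polyLT_shear_smul h.mem h.apply_mem h.apply_notMem
    (Finsupp.mem_support_iff.1 hM) hx (hrel f α fun g => ?_)⟩
  have := hf.smul (g * g₀) α hα
  rw [Finsupp.linearCombination_apply, Finsupp.sum, ← add_sum_erase _ _ hM] at this
  simpa only [smul_eq_mul, mul_smul] using this

theorem Annihilates.eq_of_adjacent [Infinite F] [IsDomain K] {W : Subrepresentation (rep F V r r' K)}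
    (hW : W ≠ ⊥) {L L' : Gr F V r r'} (h : Adjacent L L') {f : Gr F V r r' → K}
    (hf : Annihilates W f) : f L = f L' := by
  obtain ⟨e, v, φ, hE⟩ := h.exists_exchange
  obtain ⟨N, hN⟩ := exists_polyLT hW hE
  obtain ⟨t, htL, ht⟩ := hE.exists_swap
  have hconst : ∀ f, Annihilates W f → ∀ x,
      f (shear φ hE.apply_notMem x • L) = f (shear φ hE.apply_notMem 0 • L) := by
    intro f hf x
    refine const_of_polyLT
      (Q := {q | ∃ f, Annihilates W f ∧ q = fun x => f (shear φ hE.apply_notMem x • L)})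
      ?_ ?_ (N := N) ?_ ⟨f, hf, rfl⟩ x
    · rintro _ ⟨f, hf, rfl⟩ s
      refine ⟨_, hf.sub (hf.smul (shear φ hE.apply_notMem s)), ?_⟩
      ext x
      simp only [add_comm x, shear_add, mul_smul]
    · rintro _ ⟨f, hf, rfl⟩
      refine ⟨_, ⟨_, hf.smul t, rfl⟩, fun x hx => ?_⟩
      simp only [ht x hx]
    · rintro _ ⟨f, hf, rfl⟩
      exact hN f hf
  -- The swap `t` takes `L` to `L'` and fixes the point with parameter `1`, which therefore links
  -- the two values.
  have h1 := hconst f hf 1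
  have h2 := hconst _ (hf.smul t) 1
  rw [ht 1 one_ne_zero, inv_one] at h2
  rw [h1, shear_zero, one_smul, htL] at h2
  exact h2

end Main

/-! ### From annihilators back to submodules -/

section Field

variable {F : Type u} {V : Type v} [DivisionRing F] [Infinite F] [AddCommGroup V] [Module F V]
  {r r' : Cardinal.{v}} {K : Type w} [Field K]

theorem single_sub_single_mem {W : Subrepresentation (rep F V r r' K)} (hW : W ≠ ⊥)
    {L L' : Gr F V r r'} (h : Adjacent L L') :
    Finsupp.single L 1 - Finsupp.single L' 1 ∈ W.toSubmodule := by
  by_contra hcon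
  obtain ⟨l, hl, hlW⟩ := Submodule.exists_le_ker_of_notMem hcon
  have hf : Annihilates W fun M => l (Finsupp.single M 1) := by
    intro α hα
    have : Finsupp.linearCombination K (fun M => l (Finsupp.single M 1)) = l := by
      ext M
      simp
    rw [this]
    exact hlW hα
  exact hl (by rw [map_sub, hf.eq_of_adjacent hW h, sub_self])

end Field

/-! ### Transitivity on adjacent pairs and connectedness -/

section Orbits

variable {F : Type u} {V : Type v} [DivisionRing F] [AddCommGroup V] [Module F V]
  {r r' : Cardinal.{v}}

theorem Exchange.smul {L L' : Gr F V r r'} {e v : V} {φ : Module.Dual F V}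
    (h : Exchange L L' e v φ) (g : V ≃ₗ[F] V) :
    Exchange (g • L) (g • L') (g e) (g v) (φ ∘ₗ (g.symm : V →ₗ[F] V)) where
  mem := (mem_smul_iff _ _ _).2 ⟨e, h.mem, rfl⟩
  notMem hv := by
    obtain ⟨u, hu, huv⟩ := (mem_smul_iff _ _ _).1 hv
    exact h.notMem (g.injective huv ▸ hu)
  apply_mem := by simp [h.apply_mem]
  apply_notMem := by simp [h.apply_notMem]
  eq := by
    change L'.1.map (g : V →ₗ[F] V) = L.1.map (g : V →ₗ[F] V) ⊓ _ ⊔ _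
    rw [h.eq, Submodule.map_sup, Submodule.map_span, Set.image_singleton,
      Submodule.map_inf _ g.injective]
    congr 2
    ext x
    rw [Submodule.mem_map_equiv]
    rfl

theorem exists_exchange {L : Gr F V r r'} {e v : V} {φ : Module.Dual F V} (he : e ∈ L.1)
    (hv : v ∉ L.1) (hφe : φ e = 1) (hφv : φ v = 0) :
    ∃ g : V ≃ₗ[F] V, Exchange L (g • L) e v φ := by
  obtain ⟨ψ, hψ, hψv⟩ := LinearMap.exists_extend_of_notMem (0 : L.1 →ₗ[F] F) hv 1
  have hψL : ∀ u ∈ L.1, ψ u = 0 := fun u hu => LinearMap.congr_fun hψ ⟨u, hu⟩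
  obtain ⟨g, hg⟩ := exists_transvection (φ := φ + ψ) (w := v - e) (by simp [*])
  refine ⟨g, he, hv, hφe, hφv, le_antisymm ?_ (sup_le ?_ ?_)⟩
  · intro x hx
    obtain ⟨u, hu, rfl⟩ := (mem_smul_iff _ _ _).1 hx
    have e1 : g u = (u - φ u • e) + φ u • v := by
      rw [hg, LinearMap.add_apply, hψL u hu, add_zero, smul_sub]
      abel
    rw [e1]
    exact Submodule.add_mem_sup ⟨sub_mem hu (Submodule.smul_mem _ _ he), by simp [hφe]⟩
      (Submodule.smul_mem _ _ (Submodule.mem_span_singleton_self v))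
  · intro u hu
    refine (mem_smul_iff _ _ _).2 ⟨u, hu.1, ?_⟩
    rw [hg, LinearMap.add_apply, hψL u hu.1, LinearMap.mem_ker.1 hu.2]
    simp
  · rw [Submodule.span_singleton_le_iff_mem]
    exact (mem_smul_iff _ _ _).2 ⟨e, he, by rw [hg, LinearMap.add_apply, hφe, hψL e he]; simp⟩

/-- Among a form nonzero at `v`, a form nonzero at `w` and their sum, one works. -/
theorem exists_dual_ne_zero_of_notMem {M : Submodule F V} {v w : V} (hv : v ∉ M) (hw : w ∉ M) :
    ∃ ψ : Module.Dual F V, (∀ u ∈ M, ψ u = 0) ∧ ψ v ≠ 0 ∧ ψ w ≠ 0 := by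
  obtain ⟨α, hαv, hα⟩ := Submodule.exists_le_ker_of_notMem hv
  obtain ⟨β, hβw, hβ⟩ := Submodule.exists_le_ker_of_notMem hw
  by_cases hαw : α w = 0
  · by_cases hβv : β v = 0
    · refine ⟨α + β, fun u hu => ?_, ?_, ?_⟩
      · rw [LinearMap.add_apply, LinearMap.mem_ker.1 (hα hu), LinearMap.mem_ker.1 (hβ hu), add_zero]
      · rwa [LinearMap.add_apply, hβv, add_zero]
      · rwa [LinearMap.add_apply, hαw, zero_add]
    · exact ⟨β, fun u hu => LinearMap.mem_ker.1 (hβ hu), hβv, hβw⟩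
  · exact ⟨α, fun u hu => LinearMap.mem_ker.1 (hα hu), hαv, hαw⟩

theorem exists_dual_eq_one {φ : Module.Dual F V} {e : V} (he : φ e ≠ 0) :
    ∃ φ' : Module.Dual F V, φ' e = 1 ∧ ∀ u, φ' u = 0 ↔ φ u = 0 :=
  ⟨LinearMap.toSpanSingleton F F (φ e)⁻¹ ∘ₗ φ, by simp [he], by simp [he]⟩

/-- A vector outside `M` can be moved to any other one by an automorphism that fixes `M`. -/
theorem exists_fix_map_eq {M : Submodule F V} {v w : V} (hv : v ∉ M) (hw : w ∉ M) :
    ∃ g : V ≃ₗ[F] V, (∀ u ∈ M, g u = u) ∧ g v = w := by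
  obtain ⟨ψ₀, hM, hψv, hψw⟩ := exists_dual_ne_zero_of_notMem hv hw
  obtain ⟨ψ, hv1, hψ⟩ := exists_dual_eq_one hψv
  obtain ⟨g, hg⟩ := exists_transvection (φ := ψ) (w := w - v) (by
    rw [map_sub, hv1, add_sub_cancel]
    exact fun h => hψw ((hψ w).1 h))
  exact ⟨g, fun u hu => by rw [hg, (hψ u).2 (hM u hu), zero_smul, add_zero],
    by rw [hg, hv1, one_smul, add_sub_cancel]⟩

/-- Two hyperplanes of `M` are conjugate under the stabilizer of `M`. -/
theorem exists_map_inf_ker_eq [Infinite F] {M : Submodule F V} {φ φ' : Module.Dual F V} {e e' : V}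
    (he : e ∈ M) (he' : e' ∈ M) (hφ : φ e = 1) (hφ' : φ' e' = 1) :
    ∃ g : V ≃ₗ[F] V, M.map (g : V →ₗ[F] V) = M ∧
      (M ⊓ LinearMap.ker φ).map (g : V →ₗ[F] V) = M ⊓ LinearMap.ker φ' := by
  obtain ⟨e₀, he₀, hne⟩ := exists_mem_forall_notMem M (T := (Finset.univ : Finset Bool))
    (M := fun k => LinearMap.ker (cond k φ φ')) (fun k _ hle => by
      cases k
      · exact one_ne_zero (hφ' ▸ LinearMap.mem_ker.1 (hle he'))
      · exact one_ne_zero (hφ ▸ LinearMap.mem_ker.1 (hle he)))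
  obtain ⟨α, hα1, hα⟩ := exists_dual_eq_one (φ := φ) (hne true (mem_univ _))
  obtain ⟨β, hβ1, hβ⟩ := exists_dual_eq_one (φ := φ') (hne false (mem_univ _))
  -- Since `β e₀ = 1`, this `g` satisfies `β ∘ g = α`; it preserves `M` because `e₀ ∈ M`.
  obtain ⟨g, hg⟩ := exists_transvection (φ := α - β) (w := e₀) (by simp [*])
  have hgM : ∀ u, g u ∈ M ↔ u ∈ M := fun u => by
    rw [hg]
    exact Submodule.add_mem_iff_left _ (Submodule.smul_mem _ _ he₀)
  have hgβ : ∀ u, β (g u) = α u := fun u => by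
    rw [hg]
    simp [hβ1]
  refine ⟨g, Submodule.ext fun x => ?_, Submodule.ext fun x => ?_⟩
  · rw [Submodule.mem_map_equiv, ← hgM, LinearEquiv.apply_symm_apply]
  · rw [Submodule.mem_map_equiv, Submodule.mem_inf, Submodule.mem_inf, ← hgM, LinearMap.mem_ker,
      LinearMap.mem_ker, ← hα, ← hβ, ← hgβ, LinearEquiv.apply_symm_apply]

/-- Three successive moves match the first spaces, then the hyperplanes in them, then the exchanged
vectors, each preserving what is already matched. -/
theorem Adjacent.exists_smul_eq_smul_eq [Infinite F] {L L' M M' : Gr F V r r'}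
    (h : Adjacent L L') (h' : Adjacent M M') :
    ∃ g : V ≃ₗ[F] V, g • L = M ∧ g • L' = M' := by
  obtain ⟨g₁, rfl⟩ := exists_smul_eq L M
  obtain ⟨e₀, v₀, φ₀, hE₀⟩ := h.exists_exchange
  have hE := hE₀.smul g₁
  generalize g₁ e₀ = e, g₁ v₀ = v, φ₀ ∘ₗ (g₁.symm : V →ₗ[F] V) = φ at hE
  obtain ⟨e', v', φ', hE'⟩ := h'.exists_exchange
  obtain ⟨g₂, hg₂, hg₂'⟩ := exists_map_inf_ker_eq hE.mem hE'.mem hE.apply_mem hE'.apply_mem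
  have hv : g₂ v ∉ (g₁ • L).1 := by
    rw [← hg₂, Submodule.mem_map_equiv, LinearEquiv.symm_apply_apply]
    exact hE.notMem
  obtain ⟨g₃, hg₃, hg₃'⟩ := exists_fix_map_eq hv hE'.notMem
  have hfix : ∀ N ≤ (g₁ • L).1, N.map (g₃ : V →ₗ[F] V) = N := fun N hN => by
    refine Submodule.ext fun x => ⟨?_, fun hx => ⟨x, hx, hg₃ x (hN hx)⟩⟩
    rintro ⟨y, hy, rfl⟩
    exact (hg₃ y (hN hy)).symm ▸ hy
  refine ⟨g₃ * (g₂ * g₁), ?_, ?_⟩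
  · rw [mul_smul, mul_smul]
    refine Subtype.ext ?_
    change ((g₁ • L).1.map (g₂ : V →ₗ[F] V)).map (g₃ : V →ₗ[F] V) = _
    rw [hg₂, hfix _ le_rfl]
  · rw [mul_smul, mul_smul]
    refine Subtype.ext ?_
    change ((g₁ • L').1.map (g₂ : V →ₗ[F] V)).map (g₃ : V →ₗ[F] V) = _
    rw [hE.eq, hE'.eq, Submodule.map_sup, Submodule.map_sup, hg₂', hfix _ inf_le_left,
      Submodule.map_span, Submodule.map_span, Set.image_singleton, Set.image_singleton]
    change _ ⊔ Submodule.span F {g₃ (g₂ v)} = _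
    rw [hg₃']

/-- If the Grassmannian is an antichain, spaces of finite relative dimension are connected by
chains of adjacent spaces. -/
theorem eqvGen_adjacent (hanti : ∀ M N : Gr F V r r', M.1 ≤ N.1 → M = N) (N : Gr F V r r')
    (n : ℕ) : ∀ M : Gr F V r r', Module.Finite F (M.1.map N.1.mkQ) →
      Module.finrank F (M.1.map N.1.mkQ) ≤ n → Relation.EqvGen Adjacent M N := by
  induction n with
  | zero =>
    intro M _ h
    have h0 : M.1.map N.1.mkQ = ⊥ := Submodule.finrank_eq_zero.1 (Nat.le_zero.1 h)
    rw [← le_bot_iff, Submodule.map_le_iff_le_comap, Submodule.comap_bot, Submodule.ker_mkQ] at h0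
    obtain rfl := hanti M N h0
    exact Relation.EqvGen.refl M
  | succ n ih =>
    intro M _ h
    by_cases hMN : M.1 ≤ N.1
    · obtain rfl := hanti M N hMN
      exact Relation.EqvGen.refl M
    have hNM : ¬ N.1 ≤ M.1 := fun hle => hMN (hanti N M hle ▸ le_rfl)
    obtain ⟨x, hxM, hxN⟩ := SetLike.not_le_iff_exists.1 hMN
    obtain ⟨y, hyN, hyM⟩ := SetLike.not_le_iff_exists.1 hNM
    obtain ⟨φ, hφ, hφx⟩ := LinearMap.exists_extend_of_notMem (0 : N.1 →ₗ[F] F) hxN 1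
    have hφN : ∀ u ∈ N.1, φ u = 0 := fun u hu => LinearMap.congr_fun hφ ⟨u, hu⟩
    -- Exchanging `x ∈ M \ N` against `y ∈ N \ M` shrinks the image of `M` in `V ⧸ N`.
    obtain ⟨g, hE⟩ := exists_exchange hxM hyM hφx (hφN y hyN)
    have hlt : (g • M).1.map N.1.mkQ < M.1.map N.1.mkQ := by
      have e1 : (g • M).1.map N.1.mkQ = (M.1 ⊓ LinearMap.ker φ).map N.1.mkQ := by
        rw [hE.eq, Submodule.map_sup, sup_eq_left, Submodule.map_span, Set.image_singleton,
          Submodule.span_singleton_le_iff_mem, Submodule.mkQ_apply,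
          (Submodule.Quotient.mk_eq_zero _).2 hyN]
        exact zero_mem _
      rw [e1]
      refine lt_of_le_of_ne (Submodule.map_mono inf_le_left) fun heq => ?_
      have hx : N.1.mkQ x ∈ M.1.map N.1.mkQ := ⟨x, hxM, rfl⟩
      rw [← heq] at hx
      obtain ⟨d, hd, hdx⟩ := hx
      have := hφN _ ((Submodule.Quotient.eq _).1 hdx)
      rw [map_sub, hφx, LinearMap.mem_ker.1 hd.2, zero_sub, neg_eq_zero] at this
      exact one_ne_zero this
    have hfin := Submodule.finiteDimensional_of_le hlt.le
    exact (Relation.EqvGen.rel _ _ hE.adjacent).trans _ _ _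
      (ih (g • M) hfin (Nat.lt_succ_iff.1 ((Submodule.finrank_lt_finrank_of_lt hlt).trans_le h)))

theorem eqvGen_adjacent_of_lt_aleph0 (h : r < Cardinal.aleph0 ∨ r' < Cardinal.aleph0)
    (M N : Gr F V r r') : Relation.EqvGen Adjacent M N := by
  rcases h with h | h
  · have hfin : ∀ M : Gr F V r r', Module.Finite F M.1 := fun M =>
      Module.rank_lt_aleph0_iff.1 (M.2.1.trans_lt h)
    have := hfin M
    refine eqvGen_adjacent (fun M N hle => ?_) N _ M inferInstance le_rfl
    have := hfin N
    refine Subtype.ext (Submodule.eq_of_le_of_finrank_eq hle ?_)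
    rw [Module.finrank, Module.finrank, M.2.1, N.2.1]
  · have hfin : ∀ M : Gr F V r r', Module.Finite F (V ⧸ M.1) := fun M =>
      Module.rank_lt_aleph0_iff.1 (M.2.2.trans_lt h)
    have := hfin N
    refine eqvGen_adjacent (fun M N hle => ?_) N _ M inferInstance le_rfl
    have := hfin M
    have := hfin N
    have hinj : Function.Injective (Submodule.factor hle) :=
      (LinearMap.injective_iff_surjective_of_finrank_eq_finrank (by
        rw [Module.finrank, Module.finrank, M.2.2, N.2.2])).2 (Submodule.factor_surjective hle)
    refine Subtype.ext (le_antisymm hle fun x hx => ?_)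
    rw [← Submodule.Quotient.mk_eq_zero] at hx ⊢
    refine hinj ?_
    rw [map_zero]
    exact hx

end Orbits

/-! ### Existence of adjacent pairs and of incommensurable spaces -/

section Existence

variable {F : Type u} {V : Type v} [DivisionRing F] [AddCommGroup V] [Module F V]
  {r r' : Cardinal.{v}}

theorem exists_basis {ι : Type v} (h : Module.rank F V = Cardinal.mk ι) :
    Nonempty (Module.Basis ι F V) := by
  let b := Module.Basis.ofVectorSpace F V
  obtain ⟨e⟩ := Cardinal.eq.1 (b.mk_eq_rank''.trans h)
  exact ⟨b.reindex e⟩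

/-- The span of one part of a basis that is divided in two, as a point of the Grassmannian. -/
def spanInl {ι κ : Type v} (b : Module.Basis (ι ⊕ κ) F V) :
    Gr F V (Cardinal.mk ι) (Cardinal.mk κ) := by
  refine ⟨Submodule.span F (Set.range (b ∘ Sum.inl)), ?_, ?_⟩
  · rw [rank_span (b.linearIndependent.comp _ Sum.inl_injective),
      Cardinal.mk_range_eq _ (b.injective.comp Sum.inl_injective)]
  · have hc : IsCompl (Submodule.span F (Set.range (b ∘ Sum.inl)))
        (Submodule.span F (Set.range (b ∘ Sum.inr))) := by
      constructor
      · rw [Set.range_comp, Set.range_comp]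
        exact b.linearIndependent.disjoint_span_image Set.isCompl_range_inl_range_inr.disjoint
      · rw [codisjoint_iff, ← Submodule.span_union, Set.range_comp, Set.range_comp,
          ← Set.image_union, Set.range_inl_union_range_inr, Set.image_univ, b.span_eq]
    rw [(Submodule.quotientEquivOfIsCompl _ _ hc).rank_eq,
      rank_span (b.linearIndependent.comp _ Sum.inr_injective),
      Cardinal.mk_range_eq _ (b.injective.comp Sum.inr_injective)]

theorem nonempty_Gr (hV : Module.rank F V = r + r') : Nonempty (Gr F V r r') := by
  induction r using Cardinal.inductionOn with | _ ι
  induction r' using Cardinal.inductionOn with | _ κ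
  obtain ⟨b⟩ := exists_basis (F := F) (V := V) (ι := ι ⊕ κ) (by rw [hV, Cardinal.mk_sum]; simp)
  exact ⟨spanInl b⟩

theorem exists_adjacent (hr : 1 ≤ r) (hr' : 1 ≤ r') (hV : Module.rank F V = r + r') :
    ∃ L L' : Gr F V r r', Adjacent L L' := by
  obtain ⟨L⟩ := nonempty_Gr hV
  obtain ⟨e, he, he0⟩ : ∃ e ∈ L.1, e ≠ 0 := by
    refine (Submodule.ne_bot_iff _).1 fun h => ?_
    have := L.2.1
    rw [h, rank_bot] at this
    exact absurd (this ▸ hr) (by simp)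
  obtain ⟨v, hv⟩ : ∃ v, v ∉ L.1 := by
    by_contra! hcon
    have := L.2.2
    rw [Submodule.eq_top_iff'.2 hcon, rank_subsingleton'] at this
    exact absurd (this ▸ hr') (by simp)
  obtain ⟨φ, hφ, hφe⟩ := LinearMap.exists_extend_of_notMem
    (0 : Submodule.span F {v} →ₗ[F] F) (v := e) (fun h => by
      obtain ⟨a, rfl⟩ := Submodule.mem_span_singleton.1 h
      have ha : a ≠ 0 := fun h => he0 (by rw [h, zero_smul])
      exact hv ((Submodule.smul_mem_iff _ ha).1 he)) 1
  obtain ⟨g, hg⟩ := exists_exchange he hv hφe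
    (LinearMap.congr_fun hφ ⟨v, Submodule.mem_span_singleton_self v⟩)
  exact ⟨L, g • L, hg.adjacent⟩

/-- `M` contains the subspace `L` up to finite dimension. -/
def AlmostLE (L M : Submodule F V) : Prop :=
  ∃ T : Submodule F V, T.FG ∧ L ≤ M ⊔ T

/-- The one vector lost in passing to the neighbour is absorbed into the finite-dimensional part. -/
theorem AlmostLE.of_adjacent {L : Submodule F V} {M N : Gr F V r r'} (h : Adjacent M N) :
    AlmostLE L M.1 ↔ AlmostLE L N.1 := by
  obtain ⟨h1, h2⟩ := h
  rw [rank_quotient_submoduleOf_eq_one_iff] at h1 h2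
  have key : ∀ {M N : Submodule F V}, (∃ e ∈ M, e ∉ M ⊓ N ∧ ∀ u ∈ M, ∃ a : F, u - a • e ∈ M ⊓ N) →
      AlmostLE L M → AlmostLE L N := by
    rintro M N ⟨e, -, -, he⟩ ⟨T, hT, hLT⟩
    refine ⟨Submodule.span F {e} ⊔ T, (Submodule.fg_span_singleton e).sup hT, hLT.trans ?_⟩
    rw [← sup_assoc]
    refine sup_le_sup_right (fun u hu => ?_) T
    obtain ⟨a, ha⟩ := he u hu
    rw [← sub_add_cancel u (a • e)]
    exact Submodule.add_mem_sup ha.2 (Submodule.smul_mem _ _ (Submodule.mem_span_singleton_self e))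
  exact ⟨key h1, key (by rwa [inf_comm] at h2)⟩

theorem exists_not_almostLE (hr : Cardinal.aleph0 ≤ r) (hr' : Cardinal.aleph0 ≤ r')
    (hV : Module.rank F V = r + r') : ∃ L M : Gr F V r r', ¬ AlmostLE L.1 M.1 := by
  induction r using Cardinal.inductionOn with | _ ι
  induction r' using Cardinal.inductionOn with | _ κ
  have hι : Cardinal.mk (ι ⊕ ℕ) = Cardinal.mk ι := by
    rw [Cardinal.mk_sum]
    simpa using Cardinal.add_eq_left hr hr
  have hκ : Cardinal.mk (κ ⊕ ℕ) = Cardinal.mk κ := by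
    rw [Cardinal.mk_sum]
    simpa using Cardinal.add_eq_left hr' hr'
  rw [← hι, ← hκ] at hV ⊢
  obtain ⟨b⟩ := exists_basis (F := F) (V := V) (ι := (ι ⊕ ℕ) ⊕ (κ ⊕ ℕ)) (by
    rw [hV, Cardinal.mk_sum (ι ⊕ ℕ)]
    simp)
  -- Swapping the two copies of `ℕ` moves `L` to a space killed by the coordinates `π` of the first
  -- copy. As `π` maps `L` onto `ℕ →₀ F`, a finite-dimensional correction cannot suffice.
  let s : (ι ⊕ ℕ) ⊕ (κ ⊕ ℕ) → (ι ⊕ ℕ) ⊕ (κ ⊕ ℕ)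
    | .inl (.inl i) => .inl (.inl i)
    | .inl (.inr n) => .inr (.inr n)
    | .inr (.inl i) => .inr (.inl i)
    | .inr (.inr n) => .inl (.inr n)
  have hs : Function.Involutive s := by rintro ((_ | _) | (_ | _)) <;> rfl
  have hj : Function.Injective fun n : ℕ => (.inl (.inr n) : (ι ⊕ ℕ) ⊕ (κ ⊕ ℕ)) :=
    Sum.inl_injective.comp Sum.inr_injective
  let π : V →ₗ[F] ℕ →₀ F := Finsupp.lcomapDomain _ hj ∘ₗ (b.repr : V →ₗ[F] _)
  have hπ : ∀ x n, π x n = b.repr x (.inl (.inr n)) := fun _ _ => rfl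
  refine ⟨spanInl b, b.equiv b hs.toPerm • spanInl b, fun ⟨T, hT, hle⟩ => ?_⟩
  have h0 : (b.equiv b hs.toPerm • spanInl b).1 ≤ LinearMap.ker π := by
    refine Submodule.map_le_iff_le_comap.2 (Submodule.span_le.2 ?_)
    rintro _ ⟨i, rfl⟩
    refine Finsupp.ext fun n => ?_
    rcases i with i | m <;> simp [hπ, s]
  have h1 : ⊤ ≤ (spanInl b).1.map π := by
    rw [← Finsupp.basisSingleOne.span_eq, Submodule.span_le]
    rintro _ ⟨n, rfl⟩
    refine ⟨b (.inl (.inr n)), Submodule.subset_span ⟨.inr n, rfl⟩, Finsupp.ext fun m => ?_⟩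
    rw [hπ, b.repr_self, Finsupp.coe_basisSingleOne]
    exact Finsupp.single_apply_left hj n m 1
  have h2 : T.map π = ⊤ := by
    refine top_le_iff.1 (h1.trans ((Submodule.map_mono hle).trans ?_))
    rw [Submodule.map_sup, LinearMap.le_ker_iff_map.1 h0, bot_sup_eq]
  have hfin : Module.Finite F (ℕ →₀ F) := ⟨h2 ▸ hT.map π⟩
  have := Module.Finite.finite_basis (Finsupp.basisSingleOne (R := F) (ι := ℕ))
  exact not_finite ℕ

end Existence

/-! ### Base change of `M₁` and comparison with degree zero -/

section Tensor

variable {F : Type u} {V : Type v} [DivisionRing F] [AddCommGroup V] [Module F V]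
  {r r' : Cardinal.{v}} {A : Type w} [CommRing A]

@[simp]
theorem rep_single (g : V ≃ₗ[F] V) (L : Gr F V r r') (a : A) :
    rep F V r r' A g (Finsupp.single L a) = Finsupp.single (g • L) a :=
  Finsupp.mapDomain_single

@[simp]
theorem intMap_single (L : Gr F V r r') (n : ℤ) :
    intMap F V r r' A (Finsupp.single L n) = Finsupp.single L (n : A) := by
  simp [intMap]

@[simp]
theorem degree_single (L : Gr F V r r') (a : A) :
    degree F V r r' A (Finsupp.single L a) = a := by
  simp [degree]

theorem degree_rep (g : V ≃ₗ[F] V) (α : Gr F V r r' →₀ A) :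
    degree F V r r' A (rep F V r r' A g α) = degree F V r r' A α := by
  have : degree F V r r' A ∘ₗ rep F V r r' A g = degree F V r r' A := by
    ext L
    simp
  exact LinearMap.congr_fun this α

theorem tensorMap_tmul (L L' : Gr F V r r') (a : A) (m : (M1 L L').toSubmodule) :
    tensorMap A L L' (a ⊗ₜ m) = a • intMap F V r r' A m := by
  simp [tensorMap]

theorem smul_single_sub_mem_M1 (L L' : Gr F V r r') (g : V ≃ₗ[F] V) :
    Finsupp.single (g • L) 1 - Finsupp.single (g • L') 1 ∈ (M1 L L').toSubmodule :=
  Submodule.subset_span ⟨g, by simp [map_sub]⟩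

theorem single_sub_mem_tensorM1_of_mem_M1 {L L' M N : Gr F V r r'}
    (h : Finsupp.single M 1 - Finsupp.single N 1 ∈ (M1 L L').toSubmodule) :
    Finsupp.single M 1 - Finsupp.single N 1 ∈ (tensorM1 A L L').toSubmodule := by
  refine ⟨1 ⊗ₜ ⟨_, h⟩, ?_⟩
  rw [tensorMap_tmul]
  simp

theorem toSubmodule_tensorM1_le {L L' : Gr F V r r'} {N : Submodule A (Gr F V r r' →₀ A)}
    (h : ∀ g : V ≃ₗ[F] V, Finsupp.single (g • L) 1 - Finsupp.single (g • L') 1 ∈ N) :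
    (tensorM1 A L L').toSubmodule ≤ N := by
  rintro _ ⟨t, rfl⟩
  induction t using TensorProduct.induction_on with
  | zero => rw [map_zero]; exact N.zero_mem
  | add s t hs ht => rw [map_add]; exact N.add_mem hs ht
  | tmul a m =>
    rw [tensorMap_tmul]
    refine N.smul_mem a ?_
    obtain ⟨m, hm⟩ := m
    change intMap F V r r' A m ∈ N
    have hle : (M1 L L').toSubmodule ≤ (N.restrictScalars ℤ).comap (intMap F V r r' A) := by
      refine Submodule.span_le.2 ?_
      rintro _ ⟨g, rfl⟩
      simpa [map_sub] using h g
    exact hle hm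

theorem tensorM1_le {L L' : Gr F V r r'} {W : Subrepresentation (rep F V r r' A)}
    (h : Finsupp.single L 1 - Finsupp.single L' 1 ∈ W.toSubmodule) : tensorM1 A L L' ≤ W := by
  refine toSubmodule_tensorM1_le (N := W.toSubmodule) fun g => ?_
  simpa [map_sub] using W.apply_mem_toSubmodule g h

theorem single_sub_single_mem_tensorM1 (L L' : Gr F V r r') :
    Finsupp.single L 1 - Finsupp.single L' 1 ∈ (tensorM1 A L L').toSubmodule :=
  single_sub_mem_tensorM1_of_mem_M1 (by simpa using smul_single_sub_mem_M1 L L' 1)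

theorem tensorM1_ne_bot [Nontrivial A] {L L' : Gr F V r r'} (h : L ≠ L') :
    tensorM1 A L L' ≠ ⊥ := by
  intro h0
  have h1 : _ ∈ (tensorM1 A L L').toSubmodule := single_sub_single_mem_tensorM1 L L'
  rw [h0] at h1
  have h2 : Finsupp.single L (1 : A) - Finsupp.single L' 1 = 0 := h1
  exact h (Finsupp.single_left_injective one_ne_zero (sub_eq_zero.1 h2))

theorem single_sub_single_mem_degreeZero (L L' : Gr F V r r') :
    Finsupp.single L 1 - Finsupp.single L' 1 ∈ (degreeZero F V r r' A).toSubmodule := by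
  change degree F V r r' A _ = 0
  simp

theorem tensorM1_le_degreeZero (L L' : Gr F V r r') :
    tensorM1 A L L' ≤ degreeZero F V r r' A :=
  tensorM1_le (single_sub_single_mem_degreeZero L L')

theorem toSubmodule_degreeZero_le {N : Submodule A (Gr F V r r' →₀ A)}
    (h : ∀ L M : Gr F V r r', Finsupp.single L 1 - Finsupp.single M 1 ∈ N) :
    (degreeZero F V r r' A).toSubmodule ≤ N := by
  intro α hα
  have hα' : degree F V r r' A α = 0 := hα
  rcases isEmpty_or_nonempty (Gr F V r r') with hE | ⟨⟨M⟩⟩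
  · rw [Subsingleton.elim α 0]
    exact N.zero_mem
  · have : α = α.sum fun L a => a • (Finsupp.single L 1 - Finsupp.single M 1) := by
      simp only [smul_sub, Finsupp.sum_sub, Finsupp.smul_single, smul_eq_mul, mul_one]
      rw [Finsupp.sum_single, eq_comm, sub_eq_self, Finsupp.sum, ← Finsupp.single_finsetSum]
      rw [degree, Finsupp.linearCombination_apply] at hα'
      simp only [smul_eq_mul, mul_one, Finsupp.sum] at hα'
      rw [hα', Finsupp.single_zero]
    rw [this]
    exact Submodule.sum_mem _ fun L _ => N.smul_mem _ (h L M)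

theorem M1_le_degreeZero (L L' : Gr F V r r') : M1 L L' ≤ degreeZero F V r r' ℤ := by
  refine Submodule.span_le.2 ?_
  rintro _ ⟨g, rfl⟩
  exact (degreeZero F V r r' ℤ).apply_mem_toSubmodule g (single_sub_single_mem_degreeZero L L')

/-- Choose a base point `p M` in each component of the graph with edges `(g • L, g • L')`. Then `[M]
↦ [M] - [p M]` retracts `ℤ[Gr]` onto `M₁`, as both ends of an edge share a base point, and its base
change is a left inverse. -/
theorem tensorMap_injective (L L' : Gr F V r r') : Function.Injective (tensorMap A L L') := by
  let s : Setoid (Gr F V r r') :=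
    Relation.EqvGen.setoid fun M N => ∃ g : V ≃ₗ[F] V, g • L = M ∧ g • L' = N
  let p : Gr F V r r' → Gr F V r r' := fun M => (Quotient.mk s M).out
  have hmem : ∀ M N : Gr F V r r', s M N →
      Finsupp.single M 1 - Finsupp.single N 1 ∈ (M1 L L').toSubmodule := by
    intro M N h
    induction h with
    | rel M N h =>
      obtain ⟨g, rfl, rfl⟩ := h
      exact smul_single_sub_mem_M1 L L' g
    | refl M => rw [sub_self]; exact zero_mem _
    | symm M N _ h => rw [← neg_sub]; exact neg_mem h
    | trans M N P _ _ h h' => rw [← sub_add_sub_cancel]; exact add_mem h h'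
  let δ : Gr F V r r' → (M1 L L').toSubmodule := fun M =>
    ⟨_, hmem M (p M) (s.symm (Quotient.mk_out M))⟩
  let ρ := Finsupp.linearCombination ℤ δ
  have hρ : ∀ m (hm : m ∈ (M1 L L').toSubmodule), ρ m = ⟨m, hm⟩ := by
    intro m hm
    refine Subtype.ext ?_
    change ((M1 L L').toSubmodule.subtype ∘ₗ ρ) m = m
    induction hm using Submodule.span_induction with
    | mem x hx =>
      obtain ⟨g, rfl⟩ := hx
      have hp : p (g • L) = p (g • L') :=
        congrArg Quotient.out (Quotient.sound (s := s) (Relation.EqvGen.rel _ _ ⟨g, rfl, rfl⟩))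
      simp [ρ, δ, hp]
    | zero => exact map_zero _
    | add x y _ _ hx hy => rw [map_add, hx, hy]
    | smul a x _ hx => rw [map_smul, hx]
  let σ : (Gr F V r r' →₀ A) →ₗ[A] A ⊗[ℤ] (M1 L L').toSubmodule :=
    Finsupp.linearCombination A fun M => 1 ⊗ₜ δ M
  have hσ : ∀ x, σ (intMap F V r r' A x) = 1 ⊗ₜ ρ x := by
    intro x
    induction x using Finsupp.induction_linear with
    | zero => rw [map_zero, map_zero, map_zero, tmul_zero]
    | add x y hx hy => rw [map_add, map_add, map_add, hx, hy, tmul_add]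
    | single M n =>
      rw [intMap_single, Finsupp.linearCombination_single, Finsupp.linearCombination_single,
        smul_tmul', smul_eq_mul, mul_one, tmul_smul, smul_tmul', zsmul_one]
  refine Function.LeftInverse.injective (g := σ) fun t => ?_
  induction t using TensorProduct.induction_on with
  | zero => rw [map_zero, map_zero]
  | add x y hx hy => rw [map_add, map_add, hx, hy]
  | tmul a m =>
    rw [tensorMap_tmul, map_smul, hσ, hρ m.1 m.2, smul_tmul', smul_eq_mul, mul_one]

/-- A function that is constant along the orbit of a pair `(L, L')` gives a linear form that
vanishes on `A ⊗ M₁`. -/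
theorem single_sub_single_notMem_tensorM1 [Nontrivial A] {L L' M N : Gr F V r r'}
    {P : Gr F V r r' → Prop} (hP : ∀ g : V ≃ₗ[F] V, P (g • L) ↔ P (g • L')) (hM : P M)
    (hN : ¬ P N) :
    Finsupp.single M 1 - Finsupp.single N 1 ∉ (tensorM1 A L L').toSubmodule := by
  classical
  let l := Finsupp.linearCombination A fun M => if P M then (1 : A) else 0
  have hle : (tensorM1 A L L').toSubmodule ≤ LinearMap.ker l :=
    toSubmodule_tensorM1_le fun g => by simp [l, hP g]
  intro h
  have := LinearMap.mem_ker.1 (hle h)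
  simp [l, hM, hN] at this

theorem Adjacent.smul {L L' : Gr F V r r'} (h : Adjacent L L') (g : V ≃ₗ[F] V) :
    Adjacent (g • L) (g • L') :=
  let ⟨_, _, _, hE⟩ := h.exists_exchange
  (hE.smul g).adjacent

theorem M1_eq_degreeZero [Infinite F] {L L' : Gr F V r r'} (hL : Adjacent L L')
    (h : r < Cardinal.aleph0 ∨ r' < Cardinal.aleph0) : M1 L L' = degreeZero F V r r' ℤ := by
  refine le_antisymm (M1_le_degreeZero L L') (toSubmodule_degreeZero_le fun M N => ?_)
  induction eqvGen_adjacent_of_lt_aleph0 h M N with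
  | rel M N h =>
    obtain ⟨g, rfl, rfl⟩ := hL.exists_smul_eq_smul_eq h
    exact smul_single_sub_mem_M1 L L' g
  | refl M => rw [sub_self]; exact zero_mem _
  | symm M N _ h => rw [← neg_sub]; exact neg_mem h
  | trans M N P _ _ h h' => rw [← sub_add_sub_cancel]; exact add_mem h h'

theorem tensorM1_eq_degreeZero {L L' : Gr F V r r'} (h : M1 L L' = degreeZero F V r r' ℤ) :
    tensorM1 A L L' = degreeZero F V r r' A :=
  le_antisymm (tensorM1_le_degreeZero L L') (toSubmodule_degreeZero_le fun M N =>
    single_sub_mem_tensorM1_of_mem_M1 (h ▸ single_sub_single_mem_degreeZero M N))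

theorem lt_aleph0_of_tensorM1_eq [Nontrivial A] (hV : Module.rank F V = r + r')
    {L L' : Gr F V r r'} (hL : Adjacent L L')
    (h : tensorM1 A L L' = degreeZero F V r r' A) :
    r < Cardinal.aleph0 ∨ r' < Cardinal.aleph0 := by
  by_contra! hcon
  obtain ⟨M, N, hMN⟩ := exists_not_almostLE hcon.1 hcon.2 hV
  refine single_sub_single_notMem_tensorM1 (A := A) (P := fun P => AlmostLE M.1 P.1)
    (fun g => AlmostLE.of_adjacent (hL.smul g)) ⟨⊥, Submodule.fg_bot, le_sup_left⟩ hMN ?_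
  rw [h]
  exact single_sub_single_mem_degreeZero M N

end Tensor

/-! ### Irreducible subrepresentations and quotients -/

section Irreducible

variable {K : Type*} {G : Type*} {X : Type*} [Field K] [Group G] [AddCommGroup X] [Module K X]
  {ρ : Representation K G X}

theorem isIrreducible_subRep_iff {W : Subrepresentation ρ} :
    (subRep W).IsIrreducible ↔ W ≠ ⊥ ∧ ∀ U ≤ W, U = ⊥ ∨ U = W := by
  constructor
  · intro h
    refine ⟨?_, fun U hU => ?_⟩
    · rintro rfl
      refine bot_ne_top (α := Subrepresentation (subRep (⊥ : Subrepresentation ρ))) ?_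
      refine Subrepresentation.toSubmodule_injective (Submodule.ext fun x => ?_)
      exact iff_of_true (Subtype.ext x.2) trivial
    · let U' : Subrepresentation (subRep W) :=
        ⟨U.toSubmodule.comap W.toSubmodule.subtype, fun g _ hx => U.apply_mem_toSubmodule g hx⟩
      rcases eq_bot_or_eq_top U' with h | h
      · refine Or.inl (eq_bot_iff.2 fun x hx => ?_)
        have hx' : (⟨x, hU hx⟩ : W.toSubmodule) ∈ U'.toSubmodule := hx
        rw [h] at hx'
        exact congrArg Subtype.val (show _ = (0 : W.toSubmodule) from hx')
      · refine Or.inr (le_antisymm hU fun x hx => ?_)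
        have hx' : (⟨x, hx⟩ : W.toSubmodule) ∈ U'.toSubmodule := by
          rw [h]
          trivial
        exact hx'
  · rintro ⟨h0, h⟩
    refine { exists_pair_ne := ⟨⊥, ⊤, fun hbt => h0 (eq_bot_iff.2 fun x hx => ?_)⟩,
             eq_bot_or_eq_top := fun U => ?_ }
    · have hx' : (⟨x, hx⟩ : W.toSubmodule) ∈ (⊥ : Subrepresentation (subRep W)).toSubmodule := by
        rw [hbt]
        trivial
      exact congrArg Subtype.val (show _ = (0 : W.toSubmodule) from hx')
    · let U' : Subrepresentation ρ := ⟨U.toSubmodule.map W.toSubmodule.subtype, by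
        rintro g _ ⟨x, hx, rfl⟩
        exact ⟨_, U.apply_mem_toSubmodule g hx, rfl⟩⟩
      have hU' : ∀ x, x ∈ U.toSubmodule ↔ x.1 ∈ U'.toSubmodule := fun x =>
        ⟨fun hx => ⟨x, hx, rfl⟩, by rintro ⟨y, hy, hyx⟩; exact Subtype.ext hyx ▸ hy⟩
      rcases h U' (by rintro _ ⟨x, -, rfl⟩; exact x.2) with h | h
      · refine Or.inl (Subrepresentation.toSubmodule_injective (Submodule.ext fun x => ?_))
        rw [hU', h]
        exact (Subtype.ext_iff (a2 := (0 : W.toSubmodule))).symm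
      · refine Or.inr (Subrepresentation.toSubmodule_injective (Submodule.ext fun x => ?_))
        rw [hU', h]
        exact iff_of_true x.2 trivial

theorem eq_or_eq_top_of_isIrreducible_quotientRep {U W : Subrepresentation ρ}
    (h : (quotientRep U).IsIrreducible) (hUW : U ≤ W) : W = U ∨ W = ⊤ := by
  let W' : Subrepresentation (quotientRep U) := ⟨W.toSubmodule.map U.toSubmodule.mkQ, by
    rintro g _ ⟨x, hx, rfl⟩
    exact ⟨_, W.apply_mem_toSubmodule g hx, rfl⟩⟩
  have hW : W.toSubmodule = W'.toSubmodule.comap U.toSubmodule.mkQ := by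
    change _ = (W.toSubmodule.map U.toSubmodule.mkQ).comap U.toSubmodule.mkQ
    rw [Submodule.comap_map_mkQ]
    exact (sup_eq_right.2 (show U.toSubmodule ≤ W.toSubmodule from hUW)).symm
  rcases eq_bot_or_eq_top W' with h | h
  · left
    refine Subrepresentation.toSubmodule_injective ?_
    rw [hW, h]
    change (⊥ : Submodule K (X ⧸ U.toSubmodule)).comap U.toSubmodule.mkQ = _
    rw [Submodule.comap_bot, Submodule.ker_mkQ]
  · right
    refine Subrepresentation.toSubmodule_injective ?_
    rw [hW, h]
    exact Submodule.comap_top _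

theorem isIrreducible_of_linearEquiv (e : X ≃ₗ[K] K) : ρ.IsIrreducible := by
  have hs : IsSimpleModule K X := IsSimpleModule.congr e
  refine { exists_pair_ne := ⟨⊥, ⊤, fun h => ?_⟩, eq_bot_or_eq_top := fun U => ?_ }
  · exact bot_ne_top (congrArg Subrepresentation.toSubmodule h)
  · exact (eq_bot_or_eq_top U.toSubmodule).imp
      (fun h => Subrepresentation.toSubmodule_injective h)
      (fun h => Subrepresentation.toSubmodule_injective h)

end Irreducible

/-! ### The quotient by degree zero -/

section Quotient

variable {F : Type u} {V : Type v} [DivisionRing F] [AddCommGroup V] [Module F V]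
  {r r' : Cardinal.{v}} {K : Type w} [Field K]

theorem degreeZero_ne_top [h : Nonempty (Gr F V r r')] : degreeZero F V r r' K ≠ ⊤ := by
  obtain ⟨L⟩ := h
  intro h
  have : Finsupp.single L 1 ∈ (degreeZero F V r r' K).toSubmodule := by
    rw [h]
    trivial
  have h1 : degree F V r r' K (Finsupp.single L 1) = 0 := this
  rw [degree_single] at h1
  exact one_ne_zero h1

/-- The degree identifies the quotient by the elements of degree zero with the trivial
representation. -/
theorem nonempty_quotientRep_degreeZero_equiv [h : Nonempty (Gr F V r r')] :
    Nonempty ((quotientRep (degreeZero F V r r' K)).Equiv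
      (Representation.trivial K (V ≃ₗ[F] V) K)) := by
  obtain ⟨L⟩ := h
  have hsurj : Function.Surjective (degree F V r r' K) := fun a =>
    ⟨Finsupp.single L a, degree_single L a⟩
  refine ⟨Representation.Equiv.mk ((degree F V r r' K).quotKerEquivOfSurjective hsurj) fun g => ?_⟩
  refine Submodule.linearMap_qext _ (LinearMap.ext fun α => ?_)
  exact degree_rep g α

end Quotient

end GrassmannRep

theorem mainTheorem1 {F : Type*} {V : Type*} {K : Type*} [DivisionRing F] [Infinite F]
    [AddCommGroup V] [Module F V] [Field K] (r r' : Cardinal) (hr : 1 ≤ r) (hr' : 1 ≤ r')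
    (hV : Module.rank F V = r + r') :
    (∃ L L' : GrassmannRep.Gr F V r r', GrassmannRep.Adjacent L L') ∧
    ∀ L L' : GrassmannRep.Gr F V r r', GrassmannRep.Adjacent L L' →
      Function.Injective (GrassmannRep.tensorMap K L L') ∧
      (∀ W : Subrepresentation (GrassmannRep.rep F V r r' K),
        W ≠ ⊥ → GrassmannRep.tensorM1 K L L' ≤ W) ∧
      (∀ W : Subrepresentation (GrassmannRep.rep F V r r' K),
        (GrassmannRep.subRep W).IsIrreducible ↔ W = GrassmannRep.tensorM1 K L L') ∧
      List.TFAE [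
        r < Cardinal.aleph0 ∨ r' < Cardinal.aleph0,
        GrassmannRep.M1 L L' = GrassmannRep.degreeZero F V r r' ℤ,
        GrassmannRep.tensorM1 K L L' = GrassmannRep.degreeZero F V r r' K,
        (GrassmannRep.subRep (GrassmannRep.degreeZero F V r r' K)).IsIrreducible,
        (GrassmannRep.quotientRep (GrassmannRep.tensorM1 K L L')).IsIrreducible,
        Nonempty ((GrassmannRep.quotientRep (GrassmannRep.tensorM1 K L L')).Equiv
          (Representation.trivial K (V ≃ₗ[F] V) K))] := by
  refine ⟨GrassmannRep.exists_adjacent hr hr' hV, fun L L' hL => ?_⟩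
  have hmin : ∀ W : Subrepresentation (GrassmannRep.rep F V r r' K),
      W ≠ ⊥ → GrassmannRep.tensorM1 K L L' ≤ W := fun W hW =>
    GrassmannRep.tensorM1_le (GrassmannRep.single_sub_single_mem hW hL)
  have hne : GrassmannRep.tensorM1 K L L' ≠ ⊥ := GrassmannRep.tensorM1_ne_bot hL.ne
  have hirr : ∀ W : Subrepresentation (GrassmannRep.rep F V r r' K),
      (GrassmannRep.subRep W).IsIrreducible ↔ W = GrassmannRep.tensorM1 K L L' := by
    intro W
    rw [GrassmannRep.isIrreducible_subRep_iff]
    constructor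
    · rintro ⟨hW, h⟩
      exact ((h _ (hmin W hW)).resolve_left hne).symm
    · rintro rfl
      exact ⟨hne, fun U hU => or_iff_not_imp_left.2 fun hU0 => le_antisymm hU (hmin U hU0)⟩
  have : Nonempty (GrassmannRep.Gr F V r r') := ⟨L⟩
  refine ⟨GrassmannRep.tensorMap_injective L L', hmin, hirr, ?_⟩
  tfae_have 1 → 2 := GrassmannRep.M1_eq_degreeZero hL
  tfae_have 2 → 3 := GrassmannRep.tensorM1_eq_degreeZero
  tfae_have 3 → 1 := GrassmannRep.lt_aleph0_of_tensorM1_eq hV hL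
  tfae_have 3 ↔ 4 := by rw [hirr, eq_comm]
  tfae_have 3 → 6 := fun h => by
    rw [h]
    exact GrassmannRep.nonempty_quotientRep_degreeZero_equiv
  tfae_have 6 → 5 := fun ⟨e⟩ => GrassmannRep.isIrreducible_of_linearEquiv e.toLinearEquiv
  -- The proper submodule `K[Gr]°` lies above `K ⊗ M₁`, and an irreducible quotient leaves no room
  -- between.
  tfae_have 5 → 3 := fun h =>
    ((GrassmannRep.eq_or_eq_top_of_isIrreducible_quotientRep h
      (GrassmannRep.tensorM1_le_degreeZero L L')).resolve_right
      GrassmannRep.degreeZero_ne_top).symm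
  tfae_finish
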